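/- Let $N\ge 1$, $\alpha>0$, and let $A_1,\dots,A_N\in\mathbb R$ satisfy $\sum_{j=1}^N A_j=0$. Indices are taken modulo $N$ (so $T_0=T_N$, $T_{N+1}=T_1$, $A_0=A_N$). Let $T_1,\dots,T_N:\mathbb R\times[0,\infty)\to\mathbb R$ be a classical solution of $$(T_j)_t+A_j(T_j)_x-(T_j)_{xx}=T_j(1-T_j)+\alpha(T_{j-1}-T_j)+\alpha(T_{j+1}-T_j),\qquad x\in\mathbb R,\ t>0,$$ that is, each $T_j$ is continuous on $\mathbb R\times[0,\infty)$, bounded on $\mathbb R\times[0,t]$ for every $t>0$, and has continuous derivatives $(T_j)_t,(T_j)_x,(T_j)_{xx}$ on $\mathbb R\times(0,\infty)$. Assume that $0\le T_j(x,0)\le 1$ and that the initial data are front-like: each $T_j(\cdot,0)$ is differentiable and there are constants $C_0$ and $\lambda>0$ such that for all $j$ and $x$ $$T_j(x,0)<C_0e^{-\lambda x},\qquad 1-T_j(x,0)<C_0e^{\lambda x},\qquad |(T_j)_x(x,0)|<C_0e^{-\lambda|x|}.$$ Then for every $t>0$ the bulk burning rate $$V(t)=\frac1N\sum_{j=1}^N\int_{-\infty}^{\infty}(T_j)_t(x,t)\,dx,\qquad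 \int_{-\infty}^{\infty}f\,dx:=\lim_{B\to\infty}\int_{-B}^{B}f\,dx,$$ is well defined (each of the $N$ limits exists), $V$ is integrable on $[0,\tau]$ for every $\tau>0$, and $$\frac1\tau\int_0^\tau V(t)\,dt\ \ge\ \frac CN\sum_{j=1}^N|A_{j-1}-A_j|\left[\frac1{\alpha\tau^2}+\frac1{\alpha\tau}+\frac1\tau+\alpha+1\right]^{-1}\qquad\text{for every }\tau>0,$$ where $C>0$ is a universal constant, independent of $N$, $\alpha$, the $A_j$, the solution, $C_0$, $\lambda$ and $\tau$. -/

import Mathlib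

open Filter Topology MeasureTheory

namespace LayerModel

/-- The partial time derivative `(T_j)_t (x, t)`; a family of layer profiles is written
`T j x t`, with `j` the layer, `x` the position and `t` the time. -/
noncomputable def dt {N : ℕ} (T : Fin N → ℝ → ℝ → ℝ) (j : Fin N) (x t : ℝ) : ℝ :=
  deriv (fun s => T j x s) t

/-- The partial space derivative `(T_j)_x (x, t)`. -/
noncomputable def dx {N : ℕ} (T : Fin N → ℝ → ℝ → ℝ) (j : Fin N) (x t : ℝ) : ℝ :=
  deriv (fun y => T j y t) x

/-- The second partial space derivative `(T_j)_xx (x, t)`. -/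
noncomputable def dxx {N : ℕ} (T : Fin N → ℝ → ℝ → ℝ) (j : Fin N) (x t : ℝ) : ℝ :=
  deriv (fun y => dx T j y t) x

/-- `T` is a global classical solution, bounded on bounded time intervals, of the periodic
`N`-layer system
`(T_j)_t + A_j (T_j)_x - (T_j)_xx = T_j (1 - T_j) + α (T_{j-1} - T_j) + α (T_{j+1} - T_j)`.
Addition in `Fin N` is modulo `N`, so that `j - 1` and `j + 1` are the cyclic neighbours. -/
structure IsClassicalSolution {N : ℕ} [NeZero N] (α : ℝ) (A : Fin N → ℝ)
    (T : Fin N → ℝ → ℝ → ℝ) : Prop where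
  /-- Continuity up to the initial time. -/
  continuousOn : ∀ j, ContinuousOn (fun p : ℝ × ℝ => T j p.1 p.2) {p | 0 ≤ p.2}
  /-- Boundedness on each strip `ℝ × [0, t]`. -/
  bounded : ∀ t : ℝ, ∃ M : ℝ, ∀ j x s, 0 ≤ s → s ≤ t → |T j x s| ≤ M
  differentiable_time : ∀ j x t, 0 < t → DifferentiableAt ℝ (fun s => T j x s) t
  differentiable_space : ∀ j x t, 0 < t → DifferentiableAt ℝ (fun y => T j y t) x
  differentiable_space_two : ∀ j x t, 0 < t → DifferentiableAt ℝ (fun y => dx T j y t) x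
  continuousOn_dt : ∀ j, ContinuousOn (fun p : ℝ × ℝ => dt T j p.1 p.2) {p | 0 < p.2}
  continuousOn_dx : ∀ j, ContinuousOn (fun p : ℝ × ℝ => dx T j p.1 p.2) {p | 0 < p.2}
  continuousOn_dxx : ∀ j, ContinuousOn (fun p : ℝ × ℝ => dxx T j p.1 p.2) {p | 0 < p.2}
  equation : ∀ j x t, 0 < t →
    dt T j x t + A j * dx T j x t - dxx T j x t =
      T j x t * (1 - T j x t) + α * (T (j - 1) x t - T j x t) + α * (T (j + 1) x t - T j x t)

/-- Front-like initial data `f j = T_j(·, 0)`. -/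
def FrontLike {N : ℕ} (f : Fin N → ℝ → ℝ) : Prop :=
  (∀ j, Differentiable ℝ (f j)) ∧
    ∃ C₀ lam : ℝ, 0 < lam ∧ ∀ j x,
      f j x < C₀ * Real.exp (-(lam * x)) ∧
      1 - f j x < C₀ * Real.exp (lam * x) ∧
      |deriv (f j) x| < C₀ * Real.exp (-(lam * |x|))

/-- The integral of `f` over the whole line converges to `l`, in the sense of integrating over
`[-B, B]` and letting `B → ∞`. -/
def HasImproperIntegral (f : ℝ → ℝ) (l : ℝ) : Prop :=
  Tendsto (fun B : ℝ => ∫ x in (-B)..B, f x) atTop (𝓝 l)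

/-- The integral over the whole line, `lim_{B → ∞} ∫_{-B}^{B} f`. -/
noncomputable def improperIntegral (f : ℝ → ℝ) : ℝ :=
  limUnder atTop (fun B : ℝ => ∫ x in (-B)..B, f x)

/-- The bulk burning rate `V(t) = (1/N) ∑_j ∫_ℝ (T_j)_t (x, t) dx`. -/
noncomputable def bulkBurningRate {N : ℕ} (T : Fin N → ℝ → ℝ → ℝ) (t : ℝ) : ℝ :=
  (1 / (N : ℝ)) * ∑ j, improperIntegral (fun x => dt T j x t)

end LayerModel

/-!
At positive times the fluxes vanish at infinity, except that `T_j` runs from `1` to `0` and so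
transport contributes `A_j` to `∫ (T_j)_t`.  Summing over the layers, the drifts and the exchange
terms cancel, and `N V = ∫ e` with `e = ∑_j T_j (1 - T_j)` the total reaction density.  Two balance
laws then bound `E = ∫ e` from below, with `D = ∫ ∑_j (T_j - T_{j-1})²`.

* Testing the equation with `1 - 2 T_j` gives `E' ≥ -E + 2 α D`
  (`LayerModel.HasTails.energy_balance`).
* The signed sum `Φ` of the integrals of `T_j - T_{j-1}` is driven at the rate `∑_j |A_{j-1} - A_j|`
  and satisfies `Φ' ≥ ∑_j |A_{j-1} - A_j| - 2 E - 4 α (2 E + D)`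
  (`LayerModel.HasTails.difference_balance`).  Here and in `|Φ| ≤ 2 E + D` the point is the
  elementary inequality `|a - b| ≤ a (1 - a) + b (1 - b) + (a - b)²` on `[0, 1]`.

A large drift difference thus forces the layers apart, which costs either reaction or dissipation,
and the dissipation is paid for by reaction.  Integrating in time against weights that vanish at
both ends of a window eliminates `D` and all initial and final values
(`LayerModel.mul_length_le_of_differential_ineq`); the powers of `α` and of the window length in the
theorem are those produced there.  The window is `[τ / 2, τ]`, so that the argument never meets the
initial time, where the derivatives need not be controlled.

The balance laws are proved on `[-B, B]` and the boundary terms sent to zero.  This needs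
exponential tails: `0 ≤ T_j ≤ 1` and the decay of `T_j` and `1 - T_j` follow from a maximum principle for the
cooperative system on the unbounded strip (`LayerModel.nonneg_of_supersolution`), and the decay of
`(T_j)_x` from an interior gradient estimate (`LayerModel.abs_deriv_le_of_drift`), proved by
comparing the odd part of the solution about a point with a parabola.
-/

namespace LayerModel

/-! ### Maximum principle -/

theorem deriv_nonpos_of_forall_le_left {f : ℝ → ℝ} {f' a t : ℝ} (ha : a < t)
    (h : HasDerivAt f f' t) (hmin : ∀ s, a ≤ s → s ≤ t → f t ≤ f s) : f' ≤ 0 := by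
  have h1 : Tendsto (slope f t) (𝓝[<] t) (𝓝 f') :=
    h.tendsto_slope.mono_left (nhdsWithin_mono _ fun x hx => ne_of_lt hx)
  refine le_of_tendsto h1 ?_
  have h2 : ∀ᶠ s in 𝓝[<] t, a < s := nhdsWithin_le_nhds (lt_mem_nhds ha)
  filter_upwards [h2, self_mem_nhdsWithin] with s hs hst
  have hst' : s < t := hst
  rw [slope_def_field]
  exact div_nonpos_of_nonneg_of_nonpos (sub_nonneg.2 (hmin s hs.le hst'.le)) (by linarith)

theorem second_deriv_nonneg_of_isLocalMin {f f' : ℝ → ℝ} {f'' x : ℝ} (hmin : IsLocalMin f x)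
    (h1 : ∀ᶠ y in 𝓝 x, HasDerivAt f (f' y) y) (h2 : HasDerivAt f' f'' x) : 0 ≤ f'' := by
  by_contra! hneg
  have hd : deriv f =ᶠ[𝓝 x] f' := h1.mono fun y hy => hy.deriv
  have hdd : deriv (deriv f) x = f'' := by rw [hd.deriv_eq, h2.deriv]
  have hmax : IsLocalMax f x :=
    isLocalMax_of_deriv_deriv_neg (by rw [hdd]; exact hneg) hmin.deriv_eq_zero
      h1.self_of_nhds.continuousAt
  have hconst : f =ᶠ[𝓝 x] fun _ => f x := by
    filter_upwards [hmin, hmax] with y hy hy' using le_antisymm hy' hy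
  have hd0 : deriv f =ᶠ[𝓝 x] fun _ => (0 : ℝ) := by
    filter_upwards [hconst.eventuallyEq_nhds] with y hy
    rw [hy.deriv_eq]; simp
  have : deriv (deriv f) x = 0 := by rw [hd0.deriv_eq]; simp
  linarith

/-- Weak maximum principle for the cooperative system on a strip, in the form "a supersolution
that is bounded below and initially nonnegative stays nonnegative".  The differential inequality
is needed only where the function is negative. -/
theorem nonneg_of_supersolution {N : ℕ} [NeZero N] {α K M τ : ℝ} (hα : 0 ≤ α) (A : Fin N → ℝ)
    {u ut ux uxx : Fin N → ℝ → ℝ → ℝ}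
    (hc : ∀ j, ContinuousOn (fun p : ℝ × ℝ => u j p.1 p.2) {p | 0 ≤ p.2})
    (hb : ∀ j x t, 0 ≤ t → t ≤ τ → -M ≤ u j x t)
    (ht : ∀ j x t, 0 < t → HasDerivAt (fun s => u j x s) (ut j x t) t)
    (hx : ∀ j x t, 0 < t → HasDerivAt (fun y => u j y t) (ux j x t) x)
    (hxx : ∀ j x t, 0 < t → HasDerivAt (fun y => ux j y t) (uxx j x t) x)
    (h0 : ∀ j x, 0 ≤ u j x 0)
    (hL : ∀ j x t, 0 < t → t ≤ τ → u j x t < 0 →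
      K * u j x t + α * (u (j - 1) x t - u j x t) + α * (u (j + 1) x t - u j x t) ≤
        ut j x t + A j * ux j x t - uxx j x t) :
    ∀ j x t, 0 ≤ t → t ≤ τ → 0 ≤ u j x t := by
  obtain ⟨a, ha⟩ : ∃ a, ∀ j, |A j| ≤ a :=
    ⟨∑ j, |A j|, fun j => Finset.single_le_sum (f := fun j => |A j|)
      (fun i _ => abs_nonneg _) (Finset.mem_univ j)⟩
  have ha0 : 0 ≤ a := (abs_nonneg _).trans (ha 0)
  set κ : ℝ := |K| + a + 3 with hκ
  have hκ0 : 0 ≤ κ := by positivity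
  intro j₁ x₁ t₁ ht₁ ht₁τ
  have hτ : 0 ≤ τ := ht₁.trans ht₁τ
  -- The exponential factor absorbs the zeroth order term, the quadratic one forces a minimum.
  have key : ∀ ε : ℝ, 0 < ε → 0 ≤ Real.exp (-(κ * t₁)) * u j₁ x₁ t₁ + ε * (1 + x₁ ^ 2) := by
    intro ε hε
    set w : Fin N → ℝ → ℝ → ℝ :=
      fun j x t => Real.exp (-(κ * t)) * u j x t + ε * (1 + x ^ 2) with hw
    by_contra! hneg
    set R : ℝ := |x₁| + (|M| / ε + 1) with hR
    have hR0 : 0 ≤ R := by positivity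
    have hcomp : IsCompact (Set.Icc (-R) R ×ˢ Set.Icc 0 τ) := isCompact_Icc.prod isCompact_Icc
    have hmemp : ∀ x t, |x| ≤ R → 0 ≤ t → t ≤ τ → (x, t) ∈ Set.Icc (-R) R ×ˢ Set.Icc 0 τ :=
      fun x t h1 h2 h3 => ⟨abs_le.1 h1, h2, h3⟩
    have hx₁R : |x₁| ≤ R := le_add_of_nonneg_right (by positivity)
    have hwc : ∀ j, ContinuousOn (fun p : ℝ × ℝ => w j p.1 p.2)
        (Set.Icc (-R) R ×ˢ Set.Icc 0 τ) := by
      intro j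
      have h1 : ContinuousOn (fun p : ℝ × ℝ => u j p.1 p.2) (Set.Icc (-R) R ×ˢ Set.Icc 0 τ) :=
        (hc j).mono fun p hp => hp.2.1
      simp only [hw]
      fun_prop
    choose q hq hqmin using fun j =>
      hcomp.exists_isMinOn ⟨(x₁, t₁), hmemp x₁ t₁ hx₁R ht₁ ht₁τ⟩ (hwc j)
    obtain ⟨j, hj⟩ := Finite.exists_min fun j => w j (q j).1 (q j).2
    obtain ⟨x₀, t₀, hqj⟩ : ∃ x₀ t₀, q j = (x₀, t₀) := ⟨_, _, rfl⟩
    have hx₀ : |x₀| ≤ R := by have := (hq j).1; rw [hqj] at this; exact abs_le.2 this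
    have ht₀ : 0 ≤ t₀ := by have := (hq j).2.1; rwa [hqj] at this
    have ht₀τ : t₀ ≤ τ := by have := (hq j).2.2; rwa [hqj] at this
    have hminR : ∀ i x t, |x| ≤ R → 0 ≤ t → t ≤ τ → w j x₀ t₀ ≤ w i x t := by
      intro i x t h1 h2 h3
      have h4 := hj i
      rw [hqj] at h4
      exact h4.trans (hqmin i (hmemp x t h1 h2 h3))
    have hw0 : w j x₀ t₀ < 0 := (hminR j₁ x₁ t₁ hx₁R ht₁ ht₁τ).trans_lt hneg
    have hout : ∀ i x t, |M| / ε + 1 ≤ |x| → 0 ≤ t → t ≤ τ → 0 < w i x t := by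
      intro i x t h1 h2 h3
      have hexp : Real.exp (-(κ * t)) ≤ 1 := Real.exp_le_one_iff.2 (by nlinarith)
      have h4 : -|M| ≤ Real.exp (-(κ * t)) * u i x t := by
        have h5 : -|M| ≤ u i x t := (neg_le_neg (le_abs_self M)).trans (hb i x t h2 h3)
        have h6 := mul_le_mul_of_nonneg_left h5 (Real.exp_nonneg (-(κ * t)))
        nlinarith [abs_nonneg M]
      have h7 : |M| + ε ≤ ε * |x| := by
        have := mul_le_mul_of_nonneg_left h1 hε.le
        rwa [mul_add, mul_div_cancel₀ _ hε.ne', mul_one] at this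
      have h8 : |x| ≤ 1 + x ^ 2 := by nlinarith [sq_abs x, sq_nonneg (|x| - 1), abs_nonneg x]
      have h9 := mul_le_mul_of_nonneg_left h8 hε.le
      show 0 < Real.exp (-(κ * t)) * u i x t + ε * (1 + x ^ 2)
      linarith
    have hmin : ∀ i x t, 0 ≤ t → t ≤ τ → w j x₀ t₀ ≤ w i x t := by
      intro i x t h2 h3
      rcases le_total (|M| / ε + 1) |x| with h | h
      · exact hw0.le.trans (hout i x t h h2 h3).le
      · exact hminR i x t (h.trans (le_add_of_nonneg_left (abs_nonneg _))) h2 h3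
    have ht₀' : 0 < t₀ := by
      rcases ht₀.eq_or_lt with h | h
      · exfalso
        have h1 : 0 ≤ w j x₀ 0 := by
          have := h0 j x₀
          simp only [hw]
          positivity
        rw [← h] at hw0
        linarith
      · exact h
    set e := Real.exp (-(κ * t₀)) with he
    have he0 : 0 < e := Real.exp_pos _
    have hexpd : HasDerivAt (fun s => Real.exp (-(κ * s))) (e * (-κ)) t₀ := by
      have := (((hasDerivAt_id t₀).const_mul κ).neg).exp
      simpa [he] using this
    have hwt : HasDerivAt (fun s => w j x₀ s) (e * (-κ) * u j x₀ t₀ + e * ut j x₀ t₀) t₀ :=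
      (hexpd.mul (ht j x₀ t₀ ht₀')).add_const _
    have hsq : ∀ x : ℝ, HasDerivAt (fun y : ℝ => ε * (1 + y ^ 2)) (ε * (2 * x)) x := by
      intro x
      have := ((hasDerivAt_pow 2 x).const_add 1).const_mul ε
      simpa using this
    have hwx : ∀ x, HasDerivAt (fun y => w j y t₀) (e * ux j x t₀ + ε * (2 * x)) x := fun x =>
      ((hx j x t₀ ht₀').const_mul e).add (hsq x)
    have hwxx : HasDerivAt (fun y => e * ux j y t₀ + ε * (2 * y))
        (e * uxx j x₀ t₀ + ε * 2) x₀ := by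
      refine ((hxx j x₀ t₀ ht₀').const_mul e).add ?_
      simpa using ((hasDerivAt_id x₀).const_mul 2).const_mul ε
    have hlm : IsLocalMin (fun y => w j y t₀) x₀ :=
      Eventually.of_forall fun y => hmin j y t₀ ht₀ ht₀τ
    have c1 : e * (-κ) * u j x₀ t₀ + e * ut j x₀ t₀ ≤ 0 :=
      deriv_nonpos_of_forall_le_left ht₀' hwt fun s h1 h2 => hmin j x₀ s h1 (h2.trans ht₀τ)
    have c2 : e * ux j x₀ t₀ + ε * (2 * x₀) = 0 := hlm.hasDerivAt_eq_zero (hwx x₀)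
    have c3 : 0 ≤ e * uxx j x₀ t₀ + ε * 2 :=
      second_deriv_nonneg_of_isLocalMin hlm (Eventually.of_forall hwx) hwxx
    have c4 : ∀ i, u j x₀ t₀ ≤ u i x₀ t₀ := by
      intro i
      have := hmin i x₀ t₀ ht₀ ht₀τ
      simp only [hw] at this
      exact le_of_mul_le_mul_left (by linarith) he0
    have hwval : e * u j x₀ t₀ + ε * (1 + x₀ ^ 2) < 0 := hw0
    have hu0 : u j x₀ t₀ < 0 := by
      have : 0 ≤ ε * (1 + x₀ ^ 2) := by positivity
      by_contra! h
      have := mul_nonneg he0.le h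
      linarith
    have c5 := hL j x₀ t₀ ht₀' ht₀τ hu0
    have c6 : 0 ≤ α * (u (j - 1) x₀ t₀ - u j x₀ t₀) := mul_nonneg hα (sub_nonneg.2 (c4 _))
    have c7 : 0 ≤ α * (u (j + 1) x₀ t₀ - u j x₀ t₀) := mul_nonneg hα (sub_nonneg.2 (c4 _))
    have c8 : e * (K * u j x₀ t₀) ≤ e * (ut j x₀ t₀ + A j * ux j x₀ t₀ - uxx j x₀ t₀) :=
      mul_le_mul_of_nonneg_left (by linarith) he0.le
    have c9 : (κ - K) * (e * u j x₀ t₀) ≥ 2 * ε * (A j * x₀) - 2 * ε := by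
      have : e * (A j * ux j x₀ t₀) = A j * (-(ε * (2 * x₀))) := by
        rw [← eq_neg_of_add_eq_zero_left c2]; ring
      linarith
    have c10 : a + 3 ≤ κ - K := by linarith [le_abs_self K]
    have c11 : (κ - K) * (e * u j x₀ t₀) ≤ (a + 3) * (-(ε * (1 + x₀ ^ 2))) := by
      have h1 : (κ - K) * (e * u j x₀ t₀) ≤ (a + 3) * (e * u j x₀ t₀) :=
        mul_le_mul_of_nonpos_right c10 (mul_neg_of_pos_of_neg he0 hu0).le
      have h2 := mul_le_mul_of_nonneg_left hwval.le (by linarith : 0 ≤ a + 3)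
      linarith
    have c12 : -(a * (1 + x₀ ^ 2)) ≤ 2 * (A j * x₀) := by
      have h1 : |A j * x₀| ≤ a * |x₀| := by
        rw [abs_mul]; exact mul_le_mul_of_nonneg_right (ha j) (abs_nonneg _)
      have h2 : 2 * |x₀| ≤ 1 + x₀ ^ 2 := by nlinarith [sq_abs x₀, sq_nonneg (|x₀| - 1)]
      have h3 := neg_abs_le (A j * x₀)
      nlinarith
    have c13 := mul_le_mul_of_nonneg_left c12 hε.le
    have c14 := mul_nonneg hε.le (sq_nonneg x₀)
    linarith
  have hlim : 0 ≤ Real.exp (-(κ * t₁)) * u j₁ x₁ t₁ := by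
    refine le_of_forall_pos_le_add fun δ hδ => ?_
    have hp : 0 < 1 + x₁ ^ 2 := by positivity
    have := key (δ / (1 + x₁ ^ 2)) (by positivity)
    rwa [div_mul_cancel₀ _ hp.ne'] at this
  exact nonneg_of_mul_nonneg_right hlim (Real.exp_pos _)

/-! ### Interior gradient estimate -/

/-- One-sided interior gradient bound for the heat equation: the odd part of `p` about `x₀`,
multiplied by time, is compared on `[0, 1] × [0, t]` with the stationary barrier `k s (2 - s)`. -/
theorem mul_deriv_le_of_heat {p pt px pxx : ℝ → ℝ → ℝ} {x₀ t M H : ℝ} (ht : 0 < t)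
    (hM : 0 ≤ M) (hH : 0 ≤ H)
    (hc : ContinuousOn (fun q : ℝ × ℝ => p q.1 q.2) {q | 0 ≤ q.2})
    (hpt : ∀ x s, 0 < s → HasDerivAt (fun s => p x s) (pt x s) s)
    (hpx : ∀ x s, 0 < s → HasDerivAt (fun y => p y s) (px x s) x)
    (hpxx : ∀ x s, 0 < s → HasDerivAt (fun y => px y s) (pxx x s) x)
    (hbM : ∀ x s, |x - x₀| ≤ 1 → 0 ≤ s → s ≤ t → |p x s| ≤ M)
    (hbH : ∀ x s, |x - x₀| ≤ 1 → 0 < s → s ≤ t → |pt x s - pxx x s| ≤ H) :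
    t * px x₀ t ≤ (1 + 2 * t) * M + t * H := by
  refine le_of_forall_pos_le_add fun δ hδ => ?_
  set k : ℝ := (1 + 2 * t) * M + t * H + δ with hk
  have hk0 : 0 < k := by positivity
  set z : ℝ → ℝ → ℝ := fun s r => k * (s * (2 - s)) - r * (p (x₀ + s) r - p (x₀ - s) r) with hz
  have habs : ∀ s : ℝ, 0 ≤ s → s ≤ 1 → |x₀ + s - x₀| ≤ 1 ∧ |x₀ - s - x₀| ≤ 1 := by
    intro s h1 h2
    constructor <;> rw [abs_le] <;> constructor <;> linarith
  have hdiff : ∀ s r, 0 ≤ s → s ≤ 1 → 0 ≤ r → r ≤ t → p (x₀ + s) r - p (x₀ - s) r ≤ 2 * M := by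
    intro s r h1 h2 h3 h4
    have h5 := (abs_le.1 (hbM (x₀ + s) r (habs s h1 h2).1 h3 h4)).2
    have h6 := (abs_le.1 (hbM (x₀ - s) r (habs s h1 h2).2 h3 h4)).1
    linarith
  have hzn : ∀ s r, 0 ≤ s → s ≤ 1 → 0 ≤ r → r ≤ t → 0 ≤ z s r := by
    by_contra! hneg
    obtain ⟨s₁, r₁, hs₁, hs₁', hr₁, hr₁', hz₁⟩ := hneg
    have hcomp : IsCompact (Set.Icc (0 : ℝ) 1 ×ˢ Set.Icc 0 t) := isCompact_Icc.prod isCompact_Icc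
    have hzc : ContinuousOn (fun q : ℝ × ℝ => z q.1 q.2) (Set.Icc (0 : ℝ) 1 ×ˢ Set.Icc 0 t) := by
      have h1 : ContinuousOn (fun q : ℝ × ℝ => p (x₀ + q.1) q.2)
          (Set.Icc (0 : ℝ) 1 ×ˢ Set.Icc 0 t) :=
        hc.comp (f := fun q : ℝ × ℝ => (x₀ + q.1, q.2)) (by fun_prop) fun q hq => hq.2.1
      have h2 : ContinuousOn (fun q : ℝ × ℝ => p (x₀ - q.1) q.2)
          (Set.Icc (0 : ℝ) 1 ×ˢ Set.Icc 0 t) :=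
        hc.comp (f := fun q : ℝ × ℝ => (x₀ - q.1, q.2)) (by fun_prop) fun q hq => hq.2.1
      exact (by fun_prop : ContinuousOn (fun q : ℝ × ℝ => k * (q.1 * (2 - q.1))) _).sub
        (continuousOn_snd.mul (h1.sub h2))
    obtain ⟨⟨s, r⟩, ⟨⟨hs, hs'⟩, hr, hr'⟩, hmin⟩ :=
      hcomp.exists_isMinOn ⟨(s₁, r₁), ⟨hs₁, hs₁'⟩, hr₁, hr₁'⟩ hzc
    simp only at hs hs' hr hr'
    have hmin' : ∀ s' r', 0 ≤ s' → s' ≤ 1 → 0 ≤ r' → r' ≤ t → z s r ≤ z s' r' :=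
      fun s' r' h1 h2 h3 h4 => hmin
        (show (s', r') ∈ Set.Icc (0 : ℝ) 1 ×ˢ Set.Icc 0 t from ⟨⟨h1, h2⟩, h3, h4⟩)
    have hzneg : z s r < 0 := (hmin' s₁ r₁ hs₁ hs₁' hr₁ hr₁').trans_lt hz₁
    have hr0 : 0 < r := by
      rcases hr.eq_or_lt with h | h
      · exfalso
        rw [← h] at hzneg
        simp only [hz] at hzneg
        have : 0 ≤ k * (s * (2 - s)) := mul_nonneg hk0.le (mul_nonneg hs (by linarith))
        linarith
      · exact h
    have hs0 : 0 < s := by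
      rcases hs.eq_or_lt with h | h
      · exfalso
        rw [← h] at hzneg
        simp [hz] at hzneg
      · exact h
    have hrd : r * (p (x₀ + s) r - p (x₀ - s) r) ≤ t * (2 * M) :=
      (mul_le_mul_of_nonneg_left (hdiff s r hs hs' hr hr') hr).trans
        (mul_le_mul_of_nonneg_right hr' (by positivity))
    have hs1 : s < 1 := by
      rcases hs'.eq_or_lt with h | h
      · exfalso
        have h2 : k * (s * (2 - s)) = k := by rw [h]; ring
        simp only [hz] at hzneg
        have : 0 ≤ t * H := by positivity
        nlinarith
      · exact h
    have dplus : ∀ y, HasDerivAt (fun y => p (x₀ + y) r) (px (x₀ + y) r) y := fun y =>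
      (hpx (x₀ + y) r hr0).comp_const_add x₀ y
    have dminus : ∀ y, HasDerivAt (fun y => p (x₀ - y) r) (-px (x₀ - y) r) y := fun y =>
      (hpx (x₀ - y) r hr0).comp_const_sub x₀ y
    have dplus2 : HasDerivAt (fun y => px (x₀ + y) r) (pxx (x₀ + s) r) s :=
      (hpxx (x₀ + s) r hr0).comp_const_add x₀ s
    have dminus2 : HasDerivAt (fun y => px (x₀ - y) r) (-pxx (x₀ - s) r) s :=
      (hpxx (x₀ - s) r hr0).comp_const_sub x₀ s
    have hzs : ∀ y, HasDerivAt (fun y => z y r)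
        (k * (2 - 2 * y) - r * (px (x₀ + y) r - -px (x₀ - y) r)) y := by
      intro y
      refine HasDerivAt.sub ?_ (((dplus y).sub (dminus y)).const_mul r)
      exact (((hasDerivAt_id' y).mul ((hasDerivAt_id' y).const_sub 2)).const_mul k).congr_deriv
        (by ring)
    have hzss : HasDerivAt (fun y => k * (2 - 2 * y) - r * (px (x₀ + y) r - -px (x₀ - y) r))
        (k * (-2) - r * (pxx (x₀ + s) r - pxx (x₀ - s) r)) s := by
      refine HasDerivAt.sub ?_ ?_
      · exact ((((hasDerivAt_id' s).const_mul 2).const_sub 2).const_mul k).congr_deriv (by ring)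
      · exact ((dplus2.sub dminus2.neg).const_mul r).congr_deriv (by ring)
    have hzr : HasDerivAt (fun r => z s r)
        (-((p (x₀ + s) r - p (x₀ - s) r) + r * (pt (x₀ + s) r - pt (x₀ - s) r))) r := by
      have := (((hasDerivAt_id r).mul
        ((hpt (x₀ + s) r hr0).sub (hpt (x₀ - s) r hr0)))).const_sub (k * (s * (2 - s)))
      simpa using this
    have c1 := deriv_nonpos_of_forall_le_left hr0 hzr fun r' h1 h2 =>
      hmin' s r' hs hs' h1 (h2.trans hr')
    have hlm : IsLocalMin (fun y => z y r) s := by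
      filter_upwards [Ioo_mem_nhds hs0 hs1] with y hy using hmin' y r hy.1.le hy.2.le hr hr'
    have c2 := second_deriv_nonneg_of_isLocalMin hlm (Eventually.of_forall hzs) hzss
    have h1 := hdiff s r hs hs' hr hr'
    have h2 := (abs_le.1 (hbH (x₀ + s) r (habs s hs hs').1 hr0 hr')).2
    have h3 := (abs_le.1 (hbH (x₀ - s) r (habs s hs hs').2 hr0 hr')).1
    have h4 : r * ((pt (x₀ + s) r - pxx (x₀ + s) r) - (pt (x₀ - s) r - pxx (x₀ - s) r))
        ≤ t * (2 * H) :=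
      (mul_le_mul_of_nonneg_left (by linarith) hr).trans
        (mul_le_mul_of_nonneg_right hr' (by positivity))
    nlinarith [mul_nonneg ht.le hM]
  -- Since `z 0 t = 0 ≤ z s t`, the derivative of `z` in `s` at `0` is nonnegative.
  have hz0 : HasDerivAt (fun y => z y t) (2 * k - t * (px x₀ t + px x₀ t)) 0 := by
    have d1 : HasDerivAt (fun y => p (x₀ + y) t) (px x₀ t) 0 := by
      have := (hpx (x₀ + 0) t ht).comp_const_add x₀ 0
      simpa using this
    have d2 : HasDerivAt (fun y => p (x₀ - y) t) (-px x₀ t) 0 := by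
      have := (hpx (x₀ - 0) t ht).comp_const_sub x₀ 0
      simpa using this
    exact (HasDerivAt.sub (((hasDerivAt_id' (0 : ℝ)).mul
      ((hasDerivAt_id' (0 : ℝ)).const_sub 2)).const_mul k) ((d1.sub d2).const_mul t)).congr_deriv
      (by ring)
  have hz00 : z 0 t = 0 := by simp [hz]
  have h1 : Tendsto (slope (fun y => z y t) 0) (𝓝[>] 0) (𝓝 (2 * k - t * (px x₀ t + px x₀ t))) :=
    hz0.tendsto_slope.mono_left (nhdsWithin_mono _ fun x hx => ne_of_gt hx)
  have h2 : 0 ≤ 2 * k - t * (px x₀ t + px x₀ t) := by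
    refine ge_of_tendsto h1 ?_
    filter_upwards [Ioo_mem_nhdsGT (zero_lt_one : (0 : ℝ) < 1)] with s hs
    rw [slope_def_field, hz00, sub_zero, sub_zero]
    exact div_nonneg (hzn s t hs.1.le hs.2.le ht.le le_rfl) hs.1.le
  linarith

/-- Interior gradient bound for `u_t + b u_x - u_xx = g`, reduced to the heat equation by the
gauge factor `e^{-b (x - x₀) / 2}`, which removes the drift. -/
theorem abs_deriv_le_of_drift {u ut ux uxx : ℝ → ℝ → ℝ} {x₀ t M G b : ℝ} (ht : 0 < t)
    (hM : 0 ≤ M) (hG : 0 ≤ G)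
    (hc : ContinuousOn (fun q : ℝ × ℝ => u q.1 q.2) {q | 0 ≤ q.2})
    (hut : ∀ x s, 0 < s → HasDerivAt (fun s => u x s) (ut x s) s)
    (hux : ∀ x s, 0 < s → HasDerivAt (fun y => u y s) (ux x s) x)
    (huxx : ∀ x s, 0 < s → HasDerivAt (fun y => ux y s) (uxx x s) x)
    (hbM : ∀ x s, |x - x₀| ≤ 1 → 0 ≤ s → s ≤ t → |u x s| ≤ M)
    (hbG : ∀ x s, |x - x₀| ≤ 1 → 0 < s → s ≤ t → |ut x s + b * ux x s - uxx x s| ≤ G) :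
    t * |ux x₀ t| ≤ Real.exp (|b| / 2) * ((1 + 2 * t) * M + t * (G + b ^ 2 / 4 * M))
      + t * (|b| / 2 * M) := by
  set E : ℝ → ℝ := fun x => Real.exp (-(b / 2 * (x - x₀))) with hE
  have hEd : ∀ x, HasDerivAt E (E x * (-(b / 2))) x := by
    intro x
    have := ((((hasDerivAt_id x).sub_const x₀).const_mul (b / 2)).neg).exp
    simpa [hE] using this
  have hE0 : ∀ x, 0 ≤ E x := fun x => Real.exp_nonneg _
  have hEb : ∀ x, |x - x₀| ≤ 1 → E x ≤ Real.exp (|b| / 2) := by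
    intro x hx
    refine Real.exp_le_exp.2 ?_
    have h1 : |b / 2 * (x - x₀)| ≤ |b| / 2 := by
      rw [abs_mul, abs_div, abs_two]
      exact mul_le_of_le_one_right (by positivity) hx
    linarith [neg_abs_le (b / 2 * (x - x₀))]
  have main : ∀ σ : ℝ, |σ| = 1 → t * (σ * (ux x₀ t - b / 2 * u x₀ t)) ≤
      (1 + 2 * t) * (Real.exp (|b| / 2) * M)
        + t * (Real.exp (|b| / 2) * (G + b ^ 2 / 4 * M)) := by
    intro σ hσ
    have h := mul_deriv_le_of_heat (p := fun x s => σ * (E x * u x s))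
      (pt := fun x s => σ * (E x * ut x s))
      (px := fun x s => σ * (E x * (-(b / 2)) * u x s + E x * ux x s))
      (pxx := fun x s => σ * ((E x * (-(b / 2)) * (-(b / 2)) * u x s + E x * (-(b / 2)) * ux x s)
        + (E x * (-(b / 2)) * ux x s + E x * uxx x s)))
      (x₀ := x₀) (M := Real.exp (|b| / 2) * M) (H := Real.exp (|b| / 2) * (G + b ^ 2 / 4 * M))
      ht (by positivity) (by positivity)
      (by
        have hEc : Continuous E := by simp only [hE]; fun_prop
        fun_prop)
      (fun x s hs => ((hut x s hs).const_mul (E x)).const_mul σ)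
      (fun x s hs => ((hEd x).mul (hux x s hs)).const_mul σ)
      (fun x s hs => ((((hEd x).mul_const _).mul (hux x s hs)).add
        ((hEd x).mul (huxx x s hs))).const_mul σ)
      (fun x s hx h0 h1 => by
        rw [abs_mul, hσ, one_mul, abs_mul, abs_of_nonneg (hE0 x)]
        exact mul_le_mul (hEb x hx) (hbM x s hx h0 h1) (abs_nonneg _) (Real.exp_nonneg _))
      (fun x s hx h0 h1 => by
        have : σ * (E x * ut x s) - σ * ((E x * (-(b / 2)) * (-(b / 2)) * u x s
            + E x * (-(b / 2)) * ux x s) + (E x * (-(b / 2)) * ux x s + E x * uxx x s))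
            = σ * (E x * ((ut x s + b * ux x s - uxx x s) - b ^ 2 / 4 * u x s)) := by ring
        rw [this, abs_mul, hσ, one_mul, abs_mul, abs_of_nonneg (hE0 x)]
        refine mul_le_mul (hEb x hx) ?_ (abs_nonneg _) (Real.exp_nonneg _)
        refine (abs_sub _ _).trans (add_le_add (hbG x s hx h0 h1) ?_)
        rw [abs_mul, abs_of_nonneg (by positivity : (0 : ℝ) ≤ b ^ 2 / 4)]
        exact mul_le_mul_of_nonneg_left (hbM x s hx h0.le h1) (by positivity))
    have hE1 : E x₀ = 1 := by simp [hE]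
    simp only [hE1] at h
    linarith
  have h1 := main 1 (by simp)
  have h2 := main (-1) (by simp)
  have h3 : |ux x₀ t - b / 2 * u x₀ t| * t ≤ (1 + 2 * t) * (Real.exp (|b| / 2) * M)
        + t * (Real.exp (|b| / 2) * (G + b ^ 2 / 4 * M)) := by
    rcases abs_cases (ux x₀ t - b / 2 * u x₀ t) with ⟨h, _⟩ | ⟨h, _⟩ <;> rw [h] <;> linarith
  have h4 : |ux x₀ t| ≤ |ux x₀ t - b / 2 * u x₀ t| + |b| / 2 * M := by
    have h5 : |b / 2 * u x₀ t| ≤ |b| / 2 * M := by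
      rw [abs_mul, abs_div, abs_two]
      exact mul_le_mul_of_nonneg_left (hbM x₀ t (by simp) ht.le le_rfl) (by positivity)
    have h6 := abs_add_le (ux x₀ t - b / 2 * u x₀ t) (b / 2 * u x₀ t)
    rw [sub_add_cancel] at h6
    linarith
  have h7 := mul_le_mul_of_nonneg_left h4 ht.le
  linarith

/-! ### A priori bounds for the layer system -/

section Bounds

variable {N : ℕ} [NeZero N] {α : ℝ} {A : Fin N → ℝ} {T : Fin N → ℝ → ℝ → ℝ}

namespace IsClassicalSolution

theorem hasDerivAt_time (h : IsClassicalSolution α A T) (j : Fin N) (x t : ℝ) (ht : 0 < t) :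
    HasDerivAt (fun s => T j x s) (dt T j x t) t :=
  (h.differentiable_time j x t ht).hasDerivAt

theorem hasDerivAt_space (h : IsClassicalSolution α A T) (j : Fin N) (x t : ℝ) (ht : 0 < t) :
    HasDerivAt (fun y => T j y t) (dx T j x t) x :=
  (h.differentiable_space j x t ht).hasDerivAt

theorem hasDerivAt_space_two (h : IsClassicalSolution α A T) (j : Fin N) (x t : ℝ) (ht : 0 < t) :
    HasDerivAt (fun y => dx T j y t) (dxx T j x t) x :=
  (h.differentiable_space_two j x t ht).hasDerivAt

theorem nonneg (h : IsClassicalSolution α A T) (hα : 0 ≤ α) (h0 : ∀ j x, 0 ≤ T j x 0)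
    (j : Fin N) (x : ℝ) {t : ℝ} (ht : 0 ≤ t) : 0 ≤ T j x t := by
  obtain ⟨M, hM⟩ := h.bounded t
  refine nonneg_of_supersolution (K := 1 + M) (M := M) (τ := t) hα A h.continuousOn
    (fun j x s h1 h2 => (abs_le.1 (hM j x s h1 h2)).1) h.hasDerivAt_time h.hasDerivAt_space
    h.hasDerivAt_space_two h0 (fun j x s h1 h2 h3 => ?_) j x t ht le_rfl
  rw [h.equation j x s h1]
  have h4 := (abs_le.1 (hM j x s h1.le h2)).1
  nlinarith

theorem le_one (h : IsClassicalSolution α A T) (hα : 0 ≤ α)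
    (h0 : ∀ j x, 0 ≤ T j x 0 ∧ T j x 0 ≤ 1)
    (j : Fin N) (x : ℝ) {t : ℝ} (ht : 0 ≤ t) : T j x t ≤ 1 := by
  obtain ⟨M, hM⟩ := h.bounded t
  have key := nonneg_of_supersolution (K := 0) (M := M) (τ := t) hα A
    (u := fun j x s => 1 - T j x s) (ut := fun j x s => -dt T j x s)
    (ux := fun j x s => -dx T j x s) (uxx := fun j x s => -dxx T j x s)
    (fun j => continuousOn_const.sub (h.continuousOn j))
    (fun j x s h1 h2 => by linarith [(abs_le.1 (hM j x s h1 h2)).2])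
    (fun j x s hs => (h.hasDerivAt_time j x s hs).const_sub 1)
    (fun j x s hs => (h.hasDerivAt_space j x s hs).const_sub 1)
    (fun j x s hs => (h.hasDerivAt_space_two j x s hs).neg)
    (fun j x => sub_nonneg.2 (h0 j x).2)
    (fun j x s h1 h2 h3 => by
      have h4 := h.equation j x s h1
      have h5 := h.nonneg hα (fun j x => (h0 j x).1) j x h1.le
      nlinarith) j x t ht le_rfl
  linarith

/-- Exponential decay ahead of the front: for large `k`, `C e^{-λ x + k t}` is a supersolution. -/
theorem le_exp (h : IsClassicalSolution α A T) (hα : 0 ≤ α)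
    (h0 : ∀ j x, 0 ≤ T j x 0 ∧ T j x 0 ≤ 1) {C lam k : ℝ} (hC : 0 ≤ C)
    (hk : ∀ j, lam ^ 2 + A j * lam + 1 ≤ k)
    (hi : ∀ j x, T j x 0 ≤ C * Real.exp (-(lam * x)))
    (j : Fin N) (x : ℝ) {t : ℝ} (ht : 0 ≤ t) :
    T j x t ≤ C * Real.exp (-(lam * x) + k * t) := by
  have hdx : ∀ (D x s : ℝ), HasDerivAt (fun y => D * Real.exp (-(lam * y) + k * s))
      (-lam * D * Real.exp (-(lam * x) + k * s)) x := fun D x s =>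
    (((((hasDerivAt_id' x).const_mul lam).neg.add_const (k * s)).exp).const_mul D).congr_deriv
      (by simp only [Pi.neg_apply]; ring)
  have key := nonneg_of_supersolution (K := 1) (M := 1) (τ := t) hα A
    (u := fun j x s => C * Real.exp (-(lam * x) + k * s) - T j x s)
    (ut := fun j x s => C * Real.exp (-(lam * x) + k * s) * k - dt T j x s)
    (ux := fun j x s => -lam * C * Real.exp (-(lam * x) + k * s) - dx T j x s)
    (uxx := fun j x s => -lam * (-lam * C) * Real.exp (-(lam * x) + k * s) - dxx T j x s)
    (fun j => ContinuousOn.sub (by fun_prop) (h.continuousOn j))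
    (fun j x s h1 h2 => by
      have := h.le_one hα h0 j x h1
      have : 0 ≤ C * Real.exp (-(lam * x) + k * s) := by positivity
      linarith)
    (fun j x s hs => by
      refine HasDerivAt.sub ?_ (h.hasDerivAt_time j x s hs)
      exact (((((hasDerivAt_id' s).const_mul k).const_add (-(lam * x))).exp).const_mul
        C).congr_deriv (by ring))
    (fun j x s hs => (hdx C x s).sub (h.hasDerivAt_space j x s hs))
    (fun j x s hs => (hdx (-lam * C) x s).sub (h.hasDerivAt_space_two j x s hs))
    (fun j x => by simpa using hi j x)
    (fun j x s h1 h2 h3 => by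
      have h4 := h.equation j x s h1
      have h5 : 0 ≤ C * Real.exp (-(lam * x) + k * s) := by positivity
      have h6 := mul_nonneg h5 (sub_nonneg.2 (hk j))
      have h7 := sq_nonneg (T j x s)
      linarith) j x t ht le_rfl
  linarith

/-- Exponential approach to the burned state behind the front. -/
theorem one_sub_le_exp (h : IsClassicalSolution α A T) (hα : 0 ≤ α)
    (h0 : ∀ j x, 0 ≤ T j x 0 ∧ T j x 0 ≤ 1) {C lam k : ℝ} (hC : 0 ≤ C)
    (hk : ∀ j, lam ^ 2 - A j * lam + 1 ≤ k)
    (hi : ∀ j x, 1 - T j x 0 ≤ C * Real.exp (lam * x))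
    (j : Fin N) (x : ℝ) {t : ℝ} (ht : 0 ≤ t) :
    1 - T j x t ≤ C * Real.exp (lam * x + k * t) := by
  have hdx : ∀ (D x s : ℝ), HasDerivAt (fun y => D * Real.exp (lam * y + k * s))
      (lam * D * Real.exp (lam * x + k * s)) x := fun D x s =>
    (((((hasDerivAt_id' x).const_mul lam).add_const (k * s)).exp).const_mul D).congr_deriv
      (by ring)
  have key := nonneg_of_supersolution (K := 0) (M := 1) (τ := t) hα A
    (u := fun j x s => C * Real.exp (lam * x + k * s) - (1 - T j x s))
    (ut := fun j x s => C * Real.exp (lam * x + k * s) * k - -dt T j x s)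
    (ux := fun j x s => lam * C * Real.exp (lam * x + k * s) - -dx T j x s)
    (uxx := fun j x s => lam * (lam * C) * Real.exp (lam * x + k * s) - -dxx T j x s)
    (fun j => ContinuousOn.sub (by fun_prop) (continuousOn_const.sub (h.continuousOn j)))
    (fun j x s h1 h2 => by
      have := h.nonneg hα (fun j x => (h0 j x).1) j x h1
      have : 0 ≤ C * Real.exp (lam * x + k * s) := by positivity
      linarith)
    (fun j x s hs => by
      refine HasDerivAt.sub ?_ ((h.hasDerivAt_time j x s hs).const_sub 1)
      exact (((((hasDerivAt_id' s).const_mul k).const_add (lam * x)).exp).const_mul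
        C).congr_deriv (by ring))
    (fun j x s hs => (hdx C x s).sub ((h.hasDerivAt_space j x s hs).const_sub 1))
    (fun j x s hs => (hdx (lam * C) x s).sub (h.hasDerivAt_space_two j x s hs).neg)
    (fun j x => by simpa using hi j x)
    (fun j x s h1 h2 h3 => by
      have h4 := h.equation j x s h1
      have h5 : 0 ≤ C * Real.exp (lam * x + k * s) := by positivity
      have h6 := mul_nonneg h5 (sub_nonneg.2 (hk j))
      have h7 := mul_nonneg (h.nonneg hα (fun j x => (h0 j x).1) j x h1.le)
        (sub_nonneg.2 (h.le_one hα h0 j x h1.le))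
      linarith) j x t ht le_rfl
  linarith

end IsClassicalSolution

/-- Front-like bounds propagate: both tails of the solution decay exponentially, uniformly on
bounded time intervals. -/
theorem exists_tail_bounds (h : IsClassicalSolution α A T) (hα : 0 ≤ α)
    (h0 : ∀ j x, 0 ≤ T j x 0 ∧ T j x 0 ≤ 1) (hF : FrontLike (fun j x => T j x 0)) (τ : ℝ) :
    ∃ C lam : ℝ, 0 ≤ C ∧ 0 < lam ∧ ∀ j x t, 0 ≤ t → t ≤ τ →
      T j x t ≤ C * Real.exp (-(lam * x)) ∧ 1 - T j x t ≤ C * Real.exp (lam * x) := by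
  obtain ⟨-, C₀, lam, hlam, hC⟩ := hF
  have hC₀ : 0 ≤ C₀ := by
    have h1 := (h0 0 0).1.trans_lt (hC 0 0).1
    simpa using h1.le
  set a : ℝ := ∑ j, |A j| with ha_def
  have ha : ∀ j, |A j| ≤ a := fun j => Finset.single_le_sum (f := fun j => |A j|)
      (fun i _ => abs_nonneg _) (Finset.mem_univ j)
  have ha0 : 0 ≤ a := (abs_nonneg _).trans (ha 0)
  set k : ℝ := lam ^ 2 + a * lam + 1 with hk
  have hk0 : 0 ≤ k := by positivity
  refine ⟨C₀ * Real.exp (k * τ), lam, by positivity, hlam, fun j x t ht htτ => ⟨?_, ?_⟩⟩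
  · refine (h.le_exp (k := k) hα h0 hC₀ (fun j => ?_) (fun j x => (hC j x).1.le) j x ht).trans ?_
    · have := mul_le_mul_of_nonneg_right ((le_abs_self _).trans (ha j)) hlam.le
      linarith
    · rw [mul_assoc, ← Real.exp_add]
      refine mul_le_mul_of_nonneg_left (Real.exp_le_exp.2 ?_) hC₀
      linarith [mul_le_mul_of_nonneg_left htτ hk0]
  · refine (h.one_sub_le_exp (k := k) hα h0 hC₀ (fun j => ?_) (fun j x => (hC j x).2.1.le)
      j x ht).trans ?_
    · have := mul_le_mul_of_nonneg_right ((neg_le_abs _).trans (ha j)) hlam.le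
      linarith
    · rw [mul_assoc, ← Real.exp_add]
      refine mul_le_mul_of_nonneg_left (Real.exp_le_exp.2 ?_) hC₀
      linarith [mul_le_mul_of_nonneg_left htτ hk0]

/-- The interior gradient bound with constants uniform in `t ∈ [t₀, t₁]` and `|b| ≤ a`. -/
theorem abs_deriv_le_of_drift_uniform {u ut ux uxx : ℝ → ℝ → ℝ} {x₀ t₀ t₁ t M g a b : ℝ}
    (ht₀ : 0 < t₀) (ht : t₀ ≤ t) (ht₁ : t ≤ t₁) (hM : 0 ≤ M) (hg : 0 ≤ g) (hb : |b| ≤ a)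
    (hc : ContinuousOn (fun q : ℝ × ℝ => u q.1 q.2) {q | 0 ≤ q.2})
    (hut : ∀ x s, 0 < s → HasDerivAt (fun s => u x s) (ut x s) s)
    (hux : ∀ x s, 0 < s → HasDerivAt (fun y => u y s) (ux x s) x)
    (huxx : ∀ x s, 0 < s → HasDerivAt (fun y => ux y s) (uxx x s) x)
    (hbM : ∀ x s, |x - x₀| ≤ 1 → 0 ≤ s → s ≤ t → |u x s| ≤ M)
    (hbG : ∀ x s, |x - x₀| ≤ 1 → 0 < s → s ≤ t → |ut x s + b * ux x s - uxx x s| ≤ g * M) :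
    |ux x₀ t| ≤
      (Real.exp (a / 2) * ((1 + 2 * t₁) + t₁ * (g + a ^ 2 / 4)) + t₁ * (a / 2)) / t₀ * M := by
  have h := abs_deriv_le_of_drift (b := b) (ht₀.trans_le ht) hM (mul_nonneg hg hM) hc hut hux huxx
    hbM hbG
  have hb0 := abs_nonneg b
  have ha0 : 0 ≤ a := hb0.trans hb
  have htp : 0 < t := ht₀.trans_le ht
  have htp₁ : 0 < t₁ := htp.trans_le ht₁
  have hb2 : b ^ 2 ≤ a ^ 2 := by rw [← sq_abs]; gcongr
  rw [div_mul_eq_mul_div, le_div_iff₀ ht₀]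
  calc |ux x₀ t| * t₀ ≤ t * |ux x₀ t| := by
        rw [mul_comm]; exact mul_le_mul_of_nonneg_right ht (abs_nonneg _)
    _ ≤ _ := h
    _ ≤ Real.exp (a / 2) * ((1 + 2 * t₁) * M + t₁ * (g * M + a ^ 2 / 4 * M))
        + t₁ * (a / 2 * M) := by gcongr
    _ = _ := by ring

/-- The spatial derivative decays exponentially at both ends, uniformly on compact subintervals of
positive times.  This is interior regularity: no bound on the initial derivative enters. -/
theorem exists_deriv_bound (h : IsClassicalSolution α A T) (hα : 0 ≤ α)
    (h0 : ∀ j x, 0 ≤ T j x 0 ∧ T j x 0 ≤ 1) {C lam t₀ t₁ : ℝ} (ht₀ : 0 < t₀) (ht₁ : t₀ ≤ t₁)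
    (hC : 0 ≤ C) (hlam : 0 < lam)
    (hT : ∀ j x t, 0 ≤ t → t ≤ t₁ →
      T j x t ≤ C * Real.exp (-(lam * x)) ∧ 1 - T j x t ≤ C * Real.exp (lam * x)) :
    ∃ C' : ℝ, 0 ≤ C' ∧ ∀ j x t, t₀ ≤ t → t ≤ t₁ →
      |dx T j x t| ≤ C' * Real.exp (-(lam * x)) ∧ |dx T j x t| ≤ C' * Real.exp (lam * x) := by
  set a : ℝ := ∑ j, |A j| with ha_def
  have ha : ∀ j, |A j| ≤ a := fun j => Finset.single_le_sum (f := fun j => |A j|)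
      (fun i _ => abs_nonneg _) (Finset.mem_univ j)
  have ha0 : 0 ≤ a := (abs_nonneg _).trans (ha 0)
  have hp := h.nonneg hα (fun j x => (h0 j x).1)
  have hq := h.le_one hα h0
  set c : ℝ := (Real.exp (a / 2) * ((1 + 2 * t₁) + t₁ * ((1 + 4 * α) + a ^ 2 / 4))
    + t₁ * (a / 2)) / t₀ with hc
  have ht₁0 : 0 < t₁ := ht₀.trans_le ht₁
  have hc0 : 0 ≤ c := by positivity
  refine ⟨c * (C * Real.exp lam), by positivity, fun j x₀ t ht ht' => ⟨?_, ?_⟩⟩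
  · have hM : ∀ i x s, |x - x₀| ≤ 1 → 0 ≤ s → s ≤ t →
        T i x s ≤ C * Real.exp lam * Real.exp (-(lam * x₀)) := by
      intro i x s hx hs hst
      refine ((hT i x s hs (hst.trans ht')).1).trans ?_
      rw [mul_assoc, ← Real.exp_add]
      refine mul_le_mul_of_nonneg_left (Real.exp_le_exp.2 ?_) hC
      nlinarith [(abs_le.1 hx).1]
    have := abs_deriv_le_of_drift_uniform (x₀ := x₀) (g := 1 + 4 * α)
      (M := C * Real.exp lam * Real.exp (-(lam * x₀))) ht₀ ht ht' (by positivity) (by positivity)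
      (ha j) (h.continuousOn j) (h.hasDerivAt_time j) (h.hasDerivAt_space j)
      (h.hasDerivAt_space_two j)
      (fun x s hx hs hst => by
        rw [abs_of_nonneg (hp j x hs)]; exact hM j x s hx hs hst)
      (fun x s hx hs hst => by
        rw [h.equation j x s hs]
        have e1 := hM j x s hx hs.le hst
        have e2 := hM (j - 1) x s hx hs.le hst
        have e3 := hM (j + 1) x s hx hs.le hst
        have p1 := hp j x hs.le
        have p2 := hp (j - 1) x hs.le
        have p3 := hp (j + 1) x hs.le
        have q1 := mul_nonneg p1 (sub_nonneg.2 (hq j x hs.le))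
        have r1 := mul_nonneg hα p1
        have r2 := mul_nonneg hα p2
        have r3 := mul_nonneg hα p3
        have r1' := mul_le_mul_of_nonneg_left e1 hα
        have r2' := mul_le_mul_of_nonneg_left e2 hα
        have r3' := mul_le_mul_of_nonneg_left e3 hα
        rw [abs_le]
        constructor <;> nlinarith [sq_nonneg (T j x s)])
    linarith
  · have hM : ∀ i x s, |x - x₀| ≤ 1 → 0 ≤ s → s ≤ t →
        1 - T i x s ≤ C * Real.exp lam * Real.exp (lam * x₀) := by
      intro i x s hx hs hst
      refine ((hT i x s hs (hst.trans ht')).2).trans ?_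
      rw [mul_assoc, ← Real.exp_add]
      refine mul_le_mul_of_nonneg_left (Real.exp_le_exp.2 ?_) hC
      nlinarith [(abs_le.1 hx).2]
    have := abs_deriv_le_of_drift_uniform (x₀ := x₀) (g := 1 + 4 * α)
      (u := fun x s => 1 - T j x s) (ut := fun x s => -dt T j x s)
      (ux := fun x s => -dx T j x s) (uxx := fun x s => -dxx T j x s)
      (M := C * Real.exp lam * Real.exp (lam * x₀)) ht₀ ht ht' (by positivity) (by positivity)
      (ha j) (continuousOn_const.sub (h.continuousOn j))
      (fun x s hs => (h.hasDerivAt_time j x s hs).const_sub 1)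
      (fun x s hs => (h.hasDerivAt_space j x s hs).const_sub 1)
      (fun x s hs => (h.hasDerivAt_space_two j x s hs).neg)
      (fun x s hx hs hst => by
        rw [abs_of_nonneg (sub_nonneg.2 (hq j x hs))]; exact hM j x s hx hs hst)
      (fun x s hx hs hst => by
        have h4 := h.equation j x s hs
        have e0 : -dt T j x s + A j * -dx T j x s - -dxx T j x s =
          -(T j x s * (1 - T j x s)) + α * ((1 - T (j - 1) x s) - (1 - T j x s))
            + α * ((1 - T (j + 1) x s) - (1 - T j x s)) := by linarith
        rw [e0]
        have e1 := hM j x s hx hs.le hst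
        have e2 := hM (j - 1) x s hx hs.le hst
        have e3 := hM (j + 1) x s hx hs.le hst
        have p1 := sub_nonneg.2 (hq j x hs.le)
        have p2 := sub_nonneg.2 (hq (j - 1) x hs.le)
        have p3 := sub_nonneg.2 (hq (j + 1) x hs.le)
        have q1 := mul_nonneg (hp j x hs.le) p1
        have q2 : T j x s * (1 - T j x s) ≤ 1 - T j x s :=
          mul_le_of_le_one_left p1 (hq j x hs.le)
        have r1 := mul_nonneg hα p1
        have r2 := mul_nonneg hα p2
        have r3 := mul_nonneg hα p3
        have r1' := mul_le_mul_of_nonneg_left e1 hα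
        have r2' := mul_le_mul_of_nonneg_left e2 hα
        have r3' := mul_le_mul_of_nonneg_left e3 hα
        rw [abs_le]
        constructor <;> linarith)
    rw [abs_neg] at this
    linarith

end Bounds

/-! ### A weighted differential inequality -/

/-- The time weights are `η = (t - t₀) (t₁ - t) / L²` and `θ = η²`, which vanish at both ends and
satisfy `|θ'| ≤ 2 η / L`.  The combination `θ Φ + c η E` with `c = 2 + 1 / (α L)` is chosen so that
the terms in `D` produced by `Φ` are absorbed by the dissipation in the equation for `E`. -/
theorem mul_length_le_of_differential_ineq {t₀ t₁ α ρ a : ℝ} (ht : t₀ < t₁) (hα : 0 < α)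
    (hρ : 0 ≤ ρ) {E E' Φ Φ' D : ℝ → ℝ}
    (hE : ∀ t, t₀ ≤ t → t ≤ t₁ → HasDerivAt E (E' t) t)
    (hΦ : ∀ t, t₀ ≤ t → t ≤ t₁ → HasDerivAt Φ (Φ' t) t)
    (hE0 : ∀ t, t₀ ≤ t → t ≤ t₁ → 0 ≤ E t) (hD0 : ∀ t, t₀ ≤ t → t ≤ t₁ → 0 ≤ D t)
    (hE' : ∀ t, t₀ ≤ t → t ≤ t₁ → -ρ - E t + 2 * α * D t ≤ E' t)
    (hΦ' : ∀ t, t₀ ≤ t → t ≤ t₁ → a - ρ - 2 * E t - 4 * α * (2 * E t + D t) ≤ Φ' t)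
    (hΦE : ∀ t, t₀ ≤ t → t ≤ t₁ → |Φ t| ≤ 2 * E t + D t) :
    a * (t₁ - t₀) / 30 ≤
      8 * (1 / (α * (t₁ - t₀) ^ 2) + 1 / (α * (t₁ - t₀)) + 1 / (t₁ - t₀) + α + 1)
          * (∫ t in t₀..t₁, E t)
        + ρ * (3 + 1 / (α * (t₁ - t₀))) * (t₁ - t₀) := by
  set L := t₁ - t₀ with hLdef
  have hL : 0 < L := sub_pos.2 ht
  set κ := 8 * (1 / (α * L ^ 2) + 1 / (α * L) + 1 / L + α + 1) with hκ
  set c := 2 + 1 / (α * L) with hc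
  have hc0 : 0 < c := by positivity
  set η : ℝ → ℝ := fun t => (t - t₀) * (t₁ - t) / L ^ 2 with hη
  set η' : ℝ → ℝ := fun t => (t₁ + t₀ - 2 * t) / L ^ 2 with hη'
  have hηd : ∀ t, HasDerivAt η (η' t) t := fun t =>
    ((((hasDerivAt_id' t).sub_const t₀).mul ((hasDerivAt_id' t).const_sub t₁)).div_const
      (L ^ 2)).congr_deriv (by simp only [hη']; ring)
  have hηsq : ∀ t, HasDerivAt (fun t => η t ^ 2) (2 * η t * η' t) t := fun t =>
    ((hηd t).pow 2).congr_deriv (by simp)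
  have hη0 : ∀ t, t₀ ≤ t → t ≤ t₁ → 0 ≤ η t := fun t h1 h2 =>
    div_nonneg (mul_nonneg (sub_nonneg.2 h1) (sub_nonneg.2 h2)) (sq_nonneg _)
  have hη1 : ∀ t, η t ≤ 1 := by
    intro t
    simp only [hη]
    rw [div_le_one (by positivity)]
    nlinarith [sq_nonneg (2 * t - t₀ - t₁), sq_nonneg L]
  have hη'b : ∀ t, t₀ ≤ t → t ≤ t₁ → |η' t| ≤ 1 / L := by
    intro t h1 h2
    simp only [hη']
    rw [abs_div, abs_of_pos (by positivity : 0 < L ^ 2), div_le_div_iff₀ (by positivity) hL]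
    have : |t₁ + t₀ - 2 * t| ≤ L := by rw [abs_le]; constructor <;> linarith
    nlinarith
  have hHd : ∀ t, t₀ ≤ t → t ≤ t₁ → HasDerivAt (fun t => η t ^ 2 * Φ t + c * (η t * E t))
      ((2 * η t * η' t * Φ t + η t ^ 2 * Φ' t) + c * (η' t * E t + η t * E' t)) t :=
    fun t h1 h2 => ((hηsq t).mul (hΦ t h1 h2)).add (((hηd t).mul (hE t h1 h2)).const_mul c)
  have hEc : ContinuousOn E (Set.Icc t₀ t₁) := fun t h =>
    (hE t h.1 h.2).continuousAt.continuousWithinAt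
  have hηc : Continuous η := continuous_iff_continuousAt.2 fun t => (hηd t).continuousAt
  have hEi : IntervalIntegrable E volume t₀ t₁ := hEc.intervalIntegrable_of_Icc ht.le
  have hηi : IntervalIntegrable (fun t => η t ^ 2 * a) volume t₀ t₁ :=
    ((hηc.pow 2).mul continuous_const).intervalIntegrable _ _
  have hpt : ∀ t, t₀ ≤ t → t ≤ t₁ → η t ^ 2 * a - κ * E t - ρ * (1 + c) ≤
      (2 * η t * η' t * Φ t + η t ^ 2 * Φ' t) + c * (η' t * E t + η t * E' t) := by
    intro t h1 h2
    have n0 := hη0 t h1 h2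
    have n1 := hη1 t
    have e0 := hE0 t h1 h2
    have d0 := hD0 t h1 h2
    have s0 : 0 ≤ η t ^ 2 := sq_nonneg _
    have s1 : η t ^ 2 ≤ η t := by nlinarith
    have b1 : -(2 * η t * (1 / L) * (2 * E t + D t)) ≤ 2 * η t * η' t * Φ t := by
      have : |2 * η t * η' t * Φ t| ≤ 2 * η t * (1 / L) * (2 * E t + D t) := by
        rw [abs_mul, abs_mul, abs_of_nonneg (by positivity : 0 ≤ 2 * η t)]
        exact mul_le_mul (mul_le_mul_of_nonneg_left (hη'b t h1 h2) (by positivity))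
          (hΦE t h1 h2) (abs_nonneg _) (by positivity)
      exact (abs_le.1 this).1
    have b2 := mul_le_mul_of_nonneg_left (hΦ' t h1 h2) s0
    have b3 : -(1 / L * E t) ≤ η' t * E t := by
      have := mul_le_mul_of_nonneg_right (abs_le.1 (hη'b t h1 h2)).1 e0
      linarith
    have b4 := mul_le_mul_of_nonneg_left (hE' t h1 h2) n0
    have b5 := mul_le_mul_of_nonneg_left (add_le_add b3 b4) hc0.le
    have dterm : 4 * α * (η t ^ 2 * D t) + 2 * (1 / L) * (η t * D t) ≤
        c * (2 * α * (η t * D t)) := by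
      have : c * (2 * α * (η t * D t)) = 4 * α * (η t * D t) + 2 * (1 / L) * (η t * D t) := by
        rw [hc]; field_simp; ring
      rw [this]
      have := mul_le_mul_of_nonneg_right s1 d0
      nlinarith
    have hκe : κ = 8 * ((1 / L) * (c - 2)) + 8 * (c - 2) + 8 * (1 / L) + 8 * α + 8 := by
      rw [hκ, hc]; field_simp; ring
    have l0 : 0 < 1 / L := by positivity
    have c2 : 0 ≤ c - 2 := by rw [hc]; simp; positivity
    have x1 : η t ^ 2 * E t ≤ E t := mul_le_of_le_one_left e0 (s1.trans n1)
    have x2 : η t * E t ≤ E t := mul_le_of_le_one_left e0 n1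
    have x3 := mul_le_mul_of_nonneg_left x1 hα.le
    have x4 := mul_le_mul_of_nonneg_left x2 l0.le
    have x5 := mul_le_mul_of_nonneg_left x2 hc0.le
    have r1 : η t ^ 2 * ρ ≤ ρ := mul_le_of_le_one_left hρ (s1.trans n1)
    have r2 : c * (η t * ρ) ≤ c * ρ :=
      mul_le_mul_of_nonneg_left (mul_le_of_le_one_left hρ n1) hc0.le
    have y1 : 0 ≤ (1 / L) * (c - 2) * E t := by positivity
    have y2 : 0 ≤ (c - 2) * E t := by positivity
    have y3 : 0 ≤ (1 / L) * E t := by positivity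
    have y4 : 0 ≤ α * E t := by positivity
    rw [hκe]
    linarith
  have hFTC := intervalIntegral.integral_le_sub_of_hasDeriv_right_of_le ht.le
    (g := fun t => η t ^ 2 * Φ t + c * (η t * E t))
    (φ := fun t => η t ^ 2 * a - κ * E t - ρ * (1 + c))
    (fun t h => (hHd t h.1 h.2).continuousAt.continuousWithinAt)
    (fun t h => (hHd t h.1.le h.2.le).hasDerivWithinAt)
    ((((hηc.pow 2).mul continuous_const).continuousOn.sub (continuousOn_const.mul hEc)).sub
      continuousOn_const |>.integrableOn_Icc)
    (fun t h => hpt t h.1.le h.2.le)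
  have hη00 : η t₀ = 0 := by simp [hη]
  have hη11 : η t₁ = 0 := by simp [hη]
  have hθ : ∫ t in t₀..t₁, η t ^ 2 * a = L / 30 * a := by
    rw [intervalIntegral.integral_mul_const]
    congr 1
    have hd : ∀ t, HasDerivAt (fun t => (L ^ 2 / 3 * (t - t₀) ^ 3 - L / 2 * (t - t₀) ^ 4
        + 1 / 5 * (t - t₀) ^ 5) / L ^ 4) (η t ^ 2) t := by
      intro t
      have hs := (hasDerivAt_id' t).sub_const t₀
      refine (((((hs.pow 3).const_mul (L ^ 2 / 3)).sub ((hs.pow 4).const_mul (L / 2))).add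
        ((hs.pow 5).const_mul (1 / 5))).div_const (L ^ 4)).congr_deriv ?_
      have : t₁ - t = L - (t - t₀) := by rw [hLdef]; ring
      simp only [hη, this]
      field_simp
      ring
    rw [intervalIntegral.integral_eq_sub_of_hasDerivAt (fun t _ => hd t)
      ((hηc.pow 2).intervalIntegrable _ _), ← hLdef]
    field_simp
    ring
  rw [intervalIntegral.integral_sub (hηi.sub (hEi.const_mul κ)) intervalIntegrable_const,
    intervalIntegral.integral_sub hηi (hEi.const_mul κ), hθ,
    intervalIntegral.integral_const_mul, intervalIntegral.integral_const, hη00, hη11,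
    ← hLdef, smul_eq_mul] at hFTC
  have : (3 : ℝ) + 1 / (α * L) = 1 + c := by rw [hc]; ring
  rw [this]
  linarith

/-! ### Algebra of cyclic differences -/

theorem neg_le_sum_signed {ι : Type*} [Fintype ι] {σ w b : ι → ℝ} (hσ : ∀ j, |σ j| = 1)
    (hw : ∀ j, |w j| ≤ b j) :
    -∑ j, b j ≤ ∑ j, σ j * w j := by
  rw [← Finset.sum_neg_distrib]
  refine Finset.sum_le_sum fun j _ => ?_
  have : |σ j * w j| ≤ b j := by rw [abs_mul, hσ, one_mul]; exact hw j
  exact (abs_le.1 this).1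

section Cyclic

variable {N : ℕ} [NeZero N]

theorem sum_sub_one (g : Fin N → ℝ) : ∑ j, g (j - 1) = ∑ j, g j :=
  Equiv.sum_comp (Equiv.subRight (1 : Fin N)) g

theorem sum_add_one (g : Fin N → ℝ) : ∑ j, g (j + 1) = ∑ j, g j :=
  Equiv.sum_comp (Equiv.addRight (1 : Fin N)) g

/-- Summation by parts for the exchange terms tested against `1 - 2 v`. -/
theorem sum_one_sub_two_mul_exchange (v : Fin N → ℝ) :
    ∑ j, (1 - 2 * v j) * ((v (j - 1) - v j) + (v (j + 1) - v j)) =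
      2 * ∑ j, (v j - v (j - 1)) ^ 2 := by
  have h1 := sum_sub_one v
  have h2 := sum_add_one v
  have h3 := sum_sub_one fun j => v j ^ 2
  have h4 := sum_sub_one fun j => v (j + 1) * v j
  simp only [sub_add_cancel] at h4
  have e1 : ∑ j, (1 - 2 * v j) * ((v (j - 1) - v j) + (v (j + 1) - v j)) =
      ∑ j, v (j - 1) + ∑ j, v (j + 1) - 2 * ∑ j, v j - 2 * ∑ j, v j * v (j - 1)
        - 2 * ∑ j, v (j + 1) * v j + 4 * ∑ j, v j ^ 2 := by
    simp only [Finset.mul_sum, ← Finset.sum_add_distrib, ← Finset.sum_sub_distrib]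
    exact Finset.sum_congr rfl fun j _ => by ring
  have e2 : 2 * ∑ j, (v j - v (j - 1)) ^ 2 =
      2 * ∑ j, v j ^ 2 + 2 * ∑ j, v (j - 1) ^ 2 - 4 * ∑ j, v j * v (j - 1) := by
    simp only [Finset.mul_sum, ← Finset.sum_add_distrib, ← Finset.sum_sub_distrib]
    exact Finset.sum_congr rfl fun j _ => by ring
  rw [e1, e2]
  linarith

/-- For values in `[0, 1]`, a difference is controlled by the reaction terms and its square. -/
theorem abs_sub_le_reaction_add_sq {a b : ℝ} (ha0 : 0 ≤ a) (ha1 : a ≤ 1) (hb0 : 0 ≤ b)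
    (hb1 : b ≤ 1) : |a - b| ≤ a * (1 - a) + b * (1 - b) + (a - b) ^ 2 := by
  have h1 := mul_nonneg ha0 (sub_nonneg.2 hb1)
  have h2 := mul_nonneg hb0 (sub_nonneg.2 ha1)
  rw [abs_le]
  constructor <;> linarith

theorem sum_abs_sub_le (v : Fin N → ℝ) (h0 : ∀ j, 0 ≤ v j) (h1 : ∀ j, v j ≤ 1) :
    ∑ j, |v j - v (j - 1)| ≤ 2 * ∑ j, v j * (1 - v j) + ∑ j, (v j - v (j - 1)) ^ 2 := by
  have h2 := sum_sub_one fun j => v j * (1 - v j)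
  calc ∑ j, |v j - v (j - 1)| ≤ ∑ j, (v j * (1 - v j) + v (j - 1) * (1 - v (j - 1))
        + (v j - v (j - 1)) ^ 2) := Finset.sum_le_sum fun j _ =>
          abs_sub_le_reaction_add_sq (h0 _) (h1 _) (h0 _) (h1 _)
    _ = _ := by rw [Finset.sum_add_distrib, Finset.sum_add_distrib, h2]; ring

/-- Signed sums of consecutive differences of the reaction and exchange terms. -/
theorem neg_le_sum_signed_sources {α : ℝ} (hα : 0 ≤ α) {σ : Fin N → ℝ} (hσ : ∀ j, |σ j| = 1)
    (v : Fin N → ℝ) (h0 : ∀ j, 0 ≤ v j) (h1 : ∀ j, v j ≤ 1) (s : Fin N → ℝ)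
    (hs : ∀ j, s j = v j * (1 - v j) + α * (v (j - 1) - v j) + α * (v (j + 1) - v j)) :
    -(2 * ∑ j, v j * (1 - v j) + 4 * α *
        (2 * ∑ j, v j * (1 - v j) + ∑ j, (v j - v (j - 1)) ^ 2)) ≤
      ∑ j, σ j * (s j - s (j - 1)) := by
  set d : Fin N → ℝ := fun j => |v j - v (j - 1)| with hd
  have hb : ∀ j, |s j - s (j - 1)| ≤ v j * (1 - v j) + v (j - 1) * (1 - v (j - 1))
      + α * (d (j + 1) + 2 * d j + d (j - 1)) := by
    intro j
    have p1 := mul_nonneg (h0 j) (sub_nonneg.2 (h1 j))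
    have p2 := mul_nonneg (h0 (j - 1)) (sub_nonneg.2 (h1 (j - 1)))
    have hd1 : d (j + 1) = |v (j + 1) - v j| := by simp only [hd, add_sub_cancel_right]
    have a1 := abs_le.1 (le_of_eq hd1.symm)
    have a2 := abs_le.1 (le_refl (d j))
    have a3 := abs_le.1 (le_refl (d (j - 1)))
    have e : s j - s (j - 1) = v j * (1 - v j) - v (j - 1) * (1 - v (j - 1))
        + α * ((v (j + 1) - v j) - 2 * (v j - v (j - 1)) + (v (j - 1) - v (j - 1 - 1))) := by
      rw [hs, hs, sub_add_cancel]; ring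
    have b1 := mul_le_mul_of_nonneg_left
      (show (v (j + 1) - v j) - 2 * (v j - v (j - 1)) + (v (j - 1) - v (j - 1 - 1))
        ≤ d (j + 1) + 2 * d j + d (j - 1) by linarith) hα
    have b2 := mul_le_mul_of_nonneg_left
      (show -(d (j + 1) + 2 * d j + d (j - 1)) ≤
        (v (j + 1) - v j) - 2 * (v j - v (j - 1)) + (v (j - 1) - v (j - 1 - 1)) by linarith) hα
    rw [e, abs_le]
    constructor <;> linarith
  refine le_trans ?_ (neg_le_sum_signed hσ hb)
  have h2 := sum_sub_one fun j => v j * (1 - v j)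
  have h3 := sum_sub_one d
  have h4 := sum_add_one d
  have h5 := mul_le_mul_of_nonneg_left (sum_abs_sub_le v h0 h1) hα
  simp only [Finset.sum_add_distrib, ← Finset.mul_sum, h2, h3, h4]
  linarith

end Cyclic

/-! ### Integrals over the line -/

theorem integrable_exp_neg_mul_abs {lam : ℝ} (hlam : 0 < lam) :
    Integrable fun x : ℝ => Real.exp (-(lam * |x|)) := by
  rw [← integrableOn_univ, ← Set.Iic_union_Ioi (a := (0 : ℝ)), integrableOn_union]
  constructor
  · refine (integrableOn_exp_mul_Iic hlam 0).congr_fun (fun x hx => ?_) measurableSet_Iic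
    simp only [abs_of_nonpos (Set.mem_Iic.1 hx)]
    congr 1; ring
  · refine (integrableOn_exp_mul_Ioi (neg_lt_zero.2 hlam) 0).congr_fun (fun x hx => ?_)
      measurableSet_Ioi
    simp only [abs_of_pos (Set.mem_Ioi.1 hx)]
    congr 1; ring

theorem tendsto_exp_neg_mul_atTop {lam : ℝ} (hlam : 0 < lam) :
    Tendsto (fun B : ℝ => Real.exp (-(lam * B))) atTop (𝓝 0) :=
  Real.tendsto_exp_neg_atTop_nhds_zero.comp (tendsto_id.const_mul_atTop hlam)

theorem le_exp_neg_mul_abs {C lam x v : ℝ} (h1 : v ≤ C * Real.exp (-(lam * x)))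
    (h2 : v ≤ C * Real.exp (lam * x)) : v ≤ C * Real.exp (-(lam * |x|)) := by
  rcases le_total 0 x with h | h
  · rwa [abs_of_nonneg h]
  · rw [abs_of_nonpos h, mul_neg, neg_neg]; exact h2

theorem hasDerivAt_intervalIntegral_of_continuousOn {g gt : ℝ → ℝ → ℝ} {a b t : ℝ} (ht : 0 < t)
    (hg : ∀ s, 0 < s → Continuous fun x => g x s)
    (hd : ∀ x s, 0 < s → HasDerivAt (fun s => g x s) (gt x s) s)
    (hgt : ContinuousOn (fun p : ℝ × ℝ => gt p.1 p.2) {p | 0 < p.2}) :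
    HasDerivAt (fun s => ∫ x in a..b, g x s) (∫ x in a..b, gt x t) t := by
  have hcomp : IsCompact (Set.uIcc a b ×ˢ Set.Icc (t / 2) (2 * t)) :=
    isCompact_uIcc.prod isCompact_Icc
  have hpos : ∀ s ∈ Set.Icc (t / 2) (2 * t), 0 < s := fun s hs => (half_pos ht).trans_le hs.1
  obtain ⟨K, hK⟩ := hcomp.exists_bound_of_continuousOn
    (hgt.mono fun p hp => hpos p.2 hp.2)
  have hgtx : Continuous fun x => gt x t :=
    hgt.comp_continuous (f := fun x : ℝ => (x, t)) (by fun_prop) fun x => ht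
  have hn : Set.Icc (t / 2) (2 * t) ∈ 𝓝 t := Icc_mem_nhds (by linarith) (by linarith)
  refine (intervalIntegral.hasDerivAt_integral_of_dominated_loc_of_deriv_le
    (F := fun s x => g x s) (F' := fun s x => gt x s) (bound := fun _ => K) hn ?_
    ((hg t ht).intervalIntegrable _ _) hgtx.aestronglyMeasurable ?_ intervalIntegrable_const ?_).2
  · filter_upwards [hn] with s hs using (hg s (hpos s hs)).aestronglyMeasurable
  · exact Eventually.of_forall fun x hx s hs => hK (x, s) ⟨Set.uIoc_subset_uIcc hx, hs⟩
  · exact Eventually.of_forall fun x _ s hs => hd x s (hpos s hs)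

section Balance

variable {N : ℕ} {α : ℝ} {A : Fin N → ℝ} {T : Fin N → ℝ → ℝ → ℝ} {C C' lam τ t : ℝ}

/-! ### Total reaction and the burning rate -/

/-- The total reaction rate density `∑_j T_j (1 - T_j)`. -/
noncomputable def totalReaction (T : Fin N → ℝ → ℝ → ℝ) (x t : ℝ) : ℝ :=
  ∑ j, T j x t * (1 - T j x t)

theorem totalReaction_nonneg {x t : ℝ} (h : ∀ j, 0 ≤ T j x t ∧ T j x t ≤ 1) :
    0 ≤ totalReaction T x t :=
  Finset.sum_nonneg fun j _ => mul_nonneg (h j).1 (sub_nonneg.2 (h j).2)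

/-- The bounds `0 ≤ T_j ≤ 1` together with exponential tails of `T_j` and `1 - T_j` on `[0, τ]`. -/
structure HasTails (T : Fin N → ℝ → ℝ → ℝ) (C lam τ : ℝ) : Prop where
  lam_pos : 0 < lam
  mem : ∀ j x t, 0 ≤ t → t ≤ τ → 0 ≤ T j x t ∧ T j x t ≤ 1
  right : ∀ j x t, 0 ≤ t → t ≤ τ → T j x t ≤ C * Real.exp (-(lam * x))
  left : ∀ j x t, 0 ≤ t → t ≤ τ → 1 - T j x t ≤ C * Real.exp (lam * x)

theorem HasTails.reaction_le (hT : HasTails T C lam τ) (j : Fin N) (x : ℝ) (ht : 0 ≤ t)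
    (htτ : t ≤ τ) : T j x t * (1 - T j x t) ≤ C * Real.exp (-(lam * |x|)) := by
  obtain ⟨h0, h1⟩ := hT.mem j x t ht htτ
  have h2 := sub_nonneg.2 h1
  exact le_exp_neg_mul_abs
    ((mul_le_of_le_one_right h0 (by linarith)).trans (hT.right j x t ht htτ))
    ((mul_le_of_le_one_left h2 h1).trans (hT.left j x t ht htτ))

theorem HasTails.abs_sub_le (hT : HasTails T C lam τ) (i j : Fin N) (x : ℝ) (ht : 0 ≤ t)
    (htτ : t ≤ τ) : |T i x t - T j x t| ≤ C * Real.exp (-(lam * |x|)) := by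
  obtain ⟨hi0, hi1⟩ := hT.mem i x t ht htτ
  obtain ⟨hj0, hj1⟩ := hT.mem j x t ht htτ
  have ri := hT.right i x t ht htτ
  have rj := hT.right j x t ht htτ
  have li := hT.left i x t ht htτ
  have lj := hT.left j x t ht htτ
  apply le_exp_neg_mul_abs <;> rw [abs_le] <;> constructor <;> linarith

theorem HasTails.totalReaction_le (hT : HasTails T C lam τ) (x : ℝ) (ht : 0 ≤ t) (htτ : t ≤ τ) :
    totalReaction T x t ≤ N * (C * Real.exp (-(lam * |x|))) := by
  have := Finset.sum_le_card_nsmul Finset.univ (fun j => T j x t * (1 - T j x t)) _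
    fun j _ => hT.reaction_le j x ht htτ
  simpa [totalReaction] using this

variable [NeZero N]

/-- The squared differences `∑_j (T_j - T_{j-1})²` of neighbouring layers. -/
noncomputable def layerMixing (T : Fin N → ℝ → ℝ → ℝ) (x t : ℝ) : ℝ :=
  ∑ j, (T j x t - T (j - 1) x t) ^ 2

namespace IsClassicalSolution

theorem continuous_space (h : IsClassicalSolution α A T) (j : Fin N) {t : ℝ} (ht : 0 ≤ t) :
    Continuous fun x => T j x t :=
  (h.continuousOn j).comp_continuous (f := fun x : ℝ => (x, t)) (by fun_prop) fun _ => ht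

theorem continuous_dt (h : IsClassicalSolution α A T) (j : Fin N) {t : ℝ} (ht : 0 < t) :
    Continuous fun x => dt T j x t :=
  (h.continuousOn_dt j).comp_continuous (f := fun x : ℝ => (x, t)) (by fun_prop) fun _ => ht

theorem continuous_dx (h : IsClassicalSolution α A T) (j : Fin N) {t : ℝ} (ht : 0 < t) :
    Continuous fun x => dx T j x t :=
  (h.continuousOn_dx j).comp_continuous (f := fun x : ℝ => (x, t)) (by fun_prop) fun _ => ht

theorem continuous_dxx (h : IsClassicalSolution α A T) (j : Fin N) {t : ℝ} (ht : 0 < t) :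
    Continuous fun x => dxx T j x t :=
  (h.continuousOn_dxx j).comp_continuous (f := fun x : ℝ => (x, t)) (by fun_prop) fun _ => ht

theorem continuous_totalReaction (h : IsClassicalSolution α A T) {t : ℝ} (ht : 0 ≤ t) :
    Continuous fun x => totalReaction T x t :=
  continuous_finsetSum _ fun j _ =>
    (h.continuous_space j ht).mul (continuous_const.sub (h.continuous_space j ht))

theorem continuous_layerMixing (h : IsClassicalSolution α A T) {t : ℝ} (ht : 0 ≤ t) :
    Continuous fun x => layerMixing T x t :=
  continuous_finsetSum _ fun j _ =>
    ((h.continuous_space j ht).sub (h.continuous_space (j - 1) ht)).pow 2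

end IsClassicalSolution

theorem layerMixing_nonneg (x t : ℝ) : 0 ≤ layerMixing T x t :=
  Finset.sum_nonneg fun _ _ => sq_nonneg _

theorem HasTails.integrable_reaction (hT : HasTails T C lam τ) (h : IsClassicalSolution α A T)
    (j : Fin N) (ht : 0 ≤ t) (htτ : t ≤ τ) : Integrable fun x => T j x t * (1 - T j x t) := by
  refine ((integrable_exp_neg_mul_abs hT.lam_pos).const_mul C).mono'
    ((h.continuous_space j ht).mul
      (continuous_const.sub (h.continuous_space j ht))).aestronglyMeasurable
    (Eventually.of_forall fun x => ?_)
  obtain ⟨h0, h1⟩ := hT.mem j x t ht htτ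
  rw [Real.norm_of_nonneg (mul_nonneg h0 (sub_nonneg.2 h1))]
  exact hT.reaction_le j x ht htτ

theorem HasTails.integrable_sub (hT : HasTails T C lam τ) (h : IsClassicalSolution α A T)
    (i j : Fin N) (ht : 0 ≤ t) (htτ : t ≤ τ) : Integrable fun x => T i x t - T j x t :=
  ((integrable_exp_neg_mul_abs hT.lam_pos).const_mul C).mono'
    ((h.continuous_space i ht).sub (h.continuous_space j ht)).aestronglyMeasurable
    (Eventually.of_forall fun x => hT.abs_sub_le i j x ht htτ)

theorem HasTails.integrable_totalReaction (hT : HasTails T C lam τ)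
    (h : IsClassicalSolution α A T) (ht : 0 ≤ t) (htτ : t ≤ τ) :
    Integrable fun x => totalReaction T x t :=
  integrable_finsetSum _ fun j _ => hT.integrable_reaction h j ht htτ

theorem HasTails.continuousOn_integral_totalReaction (hT : HasTails T C lam τ)
    (h : IsClassicalSolution α A T) :
    ContinuousOn (fun t => ∫ x, totalReaction T x t) (Set.Icc 0 τ) := by
  refine continuousOn_of_dominated (bound := fun x => N * (C * Real.exp (-(lam * |x|))))
    (fun t ht => (h.continuous_totalReaction ht.1).aestronglyMeasurable)
    (fun t ht => Eventually.of_forall fun x => ?_)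
    (((integrable_exp_neg_mul_abs hT.lam_pos).const_mul C).const_mul _)
    (Eventually.of_forall fun x => ?_)
  · rw [Real.norm_of_nonneg (totalReaction_nonneg fun j => hT.mem j x t ht.1 ht.2)]
    exact hT.totalReaction_le x ht.1 ht.2
  · have hc : ∀ j, ContinuousOn (fun t => T j x t) (Set.Icc 0 τ) := fun j =>
      (h.continuousOn j).comp (f := fun t : ℝ => (x, t)) (by fun_prop) fun t ht => ht.1
    exact continuousOn_finsetSum _ fun j _ => (hc j).mul (continuousOn_const.sub (hc j))

/-- The antiderivative in `x` of the transport and diffusion terms. -/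
theorem IsClassicalSolution.hasDerivAt_flux (h : IsClassicalSolution α A T) (j : Fin N)
    (x : ℝ) {t : ℝ} (ht : 0 < t) :
    HasDerivAt (fun y => dx T j y t - A j * T j y t)
      (dt T j x t - (T j x t * (1 - T j x t) + α * (T (j - 1) x t - T j x t)
        + α * (T (j + 1) x t - T j x t))) x := by
  refine ((h.hasDerivAt_space_two j x t ht).sub
    ((h.hasDerivAt_space j x t ht).const_mul (A j))).congr_deriv ?_
  linarith [h.equation j x t ht]

/-- At positive times the time derivative has a convergent improper integral: the flux contributes
`A j`, since `T_j` connects `1` to `0` and its derivative vanishes at infinity. -/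
theorem HasTails.hasImproperIntegral_dt (hT : HasTails T C lam τ)
    (h : IsClassicalSolution α A T) (ht : 0 < t) (htτ : t ≤ τ)
    (hd : ∀ j x, |dx T j x t| ≤ C' * Real.exp (-(lam * x)) ∧
      |dx T j x t| ≤ C' * Real.exp (lam * x)) (j : Fin N) :
    HasImproperIntegral (fun x => dt T j x t)
      (A j + ((∫ x, T j x t * (1 - T j x t)) + α * (∫ x, T (j - 1) x t - T j x t)
        + α * (∫ x, T (j + 1) x t - T j x t))) := by
  have hexp := tendsto_exp_neg_mul_atTop hT.lam_pos
  have hzero : ∀ K : ℝ, Tendsto (fun B : ℝ => K * Real.exp (-(lam * B))) atTop (𝓝 0) := fun K => by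
    simpa using hexp.const_mul K
  have d1 : Tendsto (fun B : ℝ => dx T j B t) atTop (𝓝 0) :=
    squeeze_zero_norm (fun B => (hd j B).1) (hzero C')
  have d2 : Tendsto (fun B : ℝ => dx T j (-B) t) atTop (𝓝 0) :=
    squeeze_zero_norm (fun B => by simpa using (hd j (-B)).2) (hzero C')
  have v1 : Tendsto (fun B : ℝ => T j B t) atTop (𝓝 0) :=
    squeeze_zero (fun B => (hT.mem j B t ht.le htτ).1) (fun B => hT.right j B t ht.le htτ) (hzero C)
  have v2 : Tendsto (fun B : ℝ => 1 - T j (-B) t) atTop (𝓝 0) :=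
    squeeze_zero (fun B => sub_nonneg.2 (hT.mem j (-B) t ht.le htτ).2)
      (fun B => by simpa using hT.left j (-B) t ht.le htτ) (hzero C)
  have hflux : Tendsto (fun B : ℝ => (dx T j B t - A j * T j B t)
      - (dx T j (-B) t - A j * T j (-B) t)) atTop (𝓝 (A j)) := by
    have := ((d1.sub (v1.const_mul (A j))).sub d2).sub ((v2.const_mul (A j)).sub_const (A j))
    simp only [mul_zero, sub_zero, zero_sub, neg_neg] at this
    refine this.congr fun B => ?_
    ring
  set src : ℝ → ℝ := fun x => T j x t * (1 - T j x t) + α * (T (j - 1) x t - T j x t)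
        + α * (T (j + 1) x t - T j x t) with hsrc
  have i1 := hT.integrable_reaction h j ht.le htτ
  have i2 := (hT.integrable_sub h (j - 1) j ht.le htτ).const_mul α
  have i3 := (hT.integrable_sub h (j + 1) j ht.le htτ).const_mul α
  have hi : Integrable src := (i1.add i2).add i3
  have hs : ∫ x, src x = (∫ x, T j x t * (1 - T j x t)) + α * (∫ x, T (j - 1) x t - T j x t)
        + α * (∫ x, T (j + 1) x t - T j x t) := by
    rw [← integral_const_mul, ← integral_const_mul, ← integral_add i1 i2]
    exact integral_add (i1.add i2) i3
  rw [← hs]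
  refine (hflux.add (intervalIntegral_tendsto_integral hi tendsto_neg_atTop_atBot
    tendsto_id)).congr fun B => ?_
  have hdi : ∀ a b, IntervalIntegrable (fun x => dt T j x t) volume a b := fun a b =>
    (h.continuous_dt j ht).intervalIntegrable a b
  have hFTC := intervalIntegral.integral_eq_sub_of_hasDerivAt (a := -B) (b := B)
    (fun x _ => h.hasDerivAt_flux j x ht) ((hdi _ _).sub hi.intervalIntegrable)
  rw [intervalIntegral.integral_sub (hdi _ _) hi.intervalIntegrable] at hFTC
  simp only [id]
  linarith

/-- When the drifts sum to zero, the bulk burning rate is the mean total reaction. -/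
theorem HasTails.bulkBurningRate_eq (hT : HasTails T C lam τ) (h : IsClassicalSolution α A T)
    (hA : ∑ j, A j = 0) (ht : 0 < t) (htτ : t ≤ τ)
    (hd : ∀ j x, |dx T j x t| ≤ C' * Real.exp (-(lam * x)) ∧
      |dx T j x t| ≤ C' * Real.exp (lam * x)) :
    bulkBurningRate T t = (1 / (N : ℝ)) * ∫ x, totalReaction T x t := by
  have h1 : ∀ j, improperIntegral (fun x => dt T j x t) = _ := fun j =>
    (hT.hasImproperIntegral_dt h ht htτ hd j).limUnder_eq
  have h2 : ∫ x, totalReaction T x t = ∑ j, ∫ x, T j x t * (1 - T j x t) :=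
    integral_finsetSum _ fun j _ => hT.integrable_reaction h j ht.le htτ
  have h3 : ∑ j, ∫ x, T (j + 1) x t - T j x t = -∑ j, ∫ x, T (j - 1) x t - T j x t := by
    rw [← sum_sub_one fun j => ∫ x, T (j + 1) x t - T j x t, ← Finset.sum_neg_distrib]
    refine Finset.sum_congr rfl fun j _ => ?_
    rw [← integral_neg]
    simp
  rw [bulkBurningRate, h2]
  congr 1
  simp only [h1, Finset.sum_add_distrib, ← Finset.mul_sum, hA, h3]
  ring

/-! ### Balance laws on a bounded interval -/

theorem IsClassicalSolution.hasDerivAt_integral_totalReaction (h : IsClassicalSolution α A T)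
    (ht : 0 < t) (a b : ℝ) :
    HasDerivAt (fun t => ∫ x in a..b, totalReaction T x t)
      (∫ x in a..b, ∑ j, (1 - 2 * T j x t) * dt T j x t) t := by
  refine hasDerivAt_intervalIntegral_of_continuousOn
    (gt := fun x t => ∑ j, (1 - 2 * T j x t) * dt T j x t) ht
    (fun s hs => h.continuous_totalReaction hs.le) (fun x s hs => ?_)
    (continuousOn_finsetSum _ fun j _ => (continuousOn_const.sub (continuousOn_const.mul
      ((h.continuousOn j).mono fun p (hp : 0 < p.2) => hp.le))).mul (h.continuousOn_dt j))
  refine HasDerivAt.fun_sum fun j _ => ?_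
  have d := h.hasDerivAt_time j x s hs
  exact (d.mul (d.const_sub 1)).congr_deriv (by ring)

/-- Energy balance: the truncated total reaction grows at least at the rate of the dissipation by
exchange between layers, up to a boundary term and a multiple of itself. -/
theorem HasTails.energy_balance (hT : HasTails T C lam τ) (h : IsClassicalSolution α A T)
    {a : ℝ} (ha : ∀ j, |A j| ≤ a) (ht : 0 < t) (htτ : t ≤ τ)
    (hC : C ≤ C') (hd : ∀ j x, |dx T j x t| ≤ C' * Real.exp (-(lam * x)) ∧
      |dx T j x t| ≤ C' * Real.exp (lam * x)) {B : ℝ} (hB : 0 ≤ B) :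
    -(N * (2 * (1 + a) * (C' * Real.exp (-(lam * B))))) - (∫ x in (-B)..B, totalReaction T x t)
        + 2 * α * (∫ x in (-B)..B, layerMixing T x t) ≤
      ∫ x in (-B)..B, ∑ j, (1 - 2 * T j x t) * dt T j x t := by
  set G : ℝ → ℝ := fun x => ∑ j, ((1 - 2 * T j x t) * dx T j x t
    - A j * (T j x t * (1 - T j x t))) with hG
  set G' : ℝ → ℝ := fun x => ∑ j, ((1 - 2 * T j x t) * dxx T j x t - 2 * dx T j x t ^ 2
    - A j * ((1 - 2 * T j x t) * dx T j x t)) with hG'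
  have hc := fun j => h.continuous_space j ht.le
  have hcx := fun j => h.continuous_dx j ht
  have hcxx := fun j => h.continuous_dxx j ht
  have hct := fun j => h.continuous_dt j ht
  have hGd : ∀ x, HasDerivAt G (G' x) x := fun x => by
    refine HasDerivAt.fun_sum fun j _ => ?_
    have d0 := h.hasDerivAt_space j x t ht
    have d1 := h.hasDerivAt_space_two j x t ht
    refine ((((d0.const_mul 2).const_sub 1).mul d1).sub
      ((d0.mul (d0.const_sub 1)).const_mul (A j))).congr_deriv ?_
    ring
  have hG'c : Continuous G' := by fun_prop
  have hEc := h.continuous_totalReaction ht.le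
  have hDc := h.continuous_layerMixing ht.le
  have hGb : ∀ x, |x| = B → |G x| ≤ N * ((1 + a) * (C' * Real.exp (-(lam * B)))) := by
    intro x hx
    have hterm : ∀ j, |(1 - 2 * T j x t) * dx T j x t - A j * (T j x t * (1 - T j x t))| ≤
        (1 + a) * (C' * Real.exp (-(lam * B))) := by
      intro j
      obtain ⟨m0, m1⟩ := hT.mem j x t ht.le htτ
      have e1 : |dx T j x t| ≤ C' * Real.exp (-(lam * B)) := by
        rw [← hx]; exact le_exp_neg_mul_abs (hd j x).1 (hd j x).2
      have e2 : T j x t * (1 - T j x t) ≤ C' * Real.exp (-(lam * B)) := by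
        rw [← hx]
        exact (hT.reaction_le j x ht.le htτ).trans
          (mul_le_mul_of_nonneg_right hC (Real.exp_nonneg _))
      have e3 : 0 ≤ T j x t * (1 - T j x t) := mul_nonneg m0 (sub_nonneg.2 m1)
      have e4 : |1 - 2 * T j x t| ≤ 1 := by rw [abs_le]; constructor <;> linarith
      have e5 : |(1 - 2 * T j x t) * dx T j x t| ≤ 1 * (C' * Real.exp (-(lam * B))) := by
        rw [abs_mul]; exact mul_le_mul e4 e1 (abs_nonneg _) zero_le_one
      have e6 : |A j * (T j x t * (1 - T j x t))| ≤ a * (C' * Real.exp (-(lam * B))) := by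
        rw [abs_mul, abs_of_nonneg e3]
        exact mul_le_mul (ha j) e2 e3 ((abs_nonneg _).trans (ha j))
      have := abs_sub ((1 - 2 * T j x t) * dx T j x t) (A j * (T j x t * (1 - T j x t)))
      linarith
    refine (Finset.abs_sum_le_sum_abs _ _).trans ?_
    have := Finset.sum_le_card_nsmul Finset.univ _ _ fun j _ => hterm j
    simpa using this
  have hpt : ∀ x, G' x - totalReaction T x t + 2 * α * layerMixing T x t ≤
      ∑ j, (1 - 2 * T j x t) * dt T j x t := by
    intro x
    have hmix := sum_one_sub_two_mul_exchange fun j => T j x t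
    have : 2 * α * layerMixing T x t = ∑ j, α * ((1 - 2 * T j x t) *
        ((T (j - 1) x t - T j x t) + (T (j + 1) x t - T j x t))) := by
      rw [← Finset.mul_sum, hmix, layerMixing]; ring
    rw [this]
    simp only [hG', totalReaction, ← Finset.sum_sub_distrib, ← Finset.sum_add_distrib]
    refine Finset.sum_le_sum fun j _ => ?_
    obtain ⟨m0, m1⟩ := hT.mem j x t ht.le htτ
    have e3 : 0 ≤ (T j x t * (1 - T j x t)) * (1 - T j x t) :=
      mul_nonneg (mul_nonneg m0 (sub_nonneg.2 m1)) (sub_nonneg.2 m1)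
    have e4 : dt T j x t = dxx T j x t - A j * dx T j x t + (T j x t * (1 - T j x t)
        + α * (T (j - 1) x t - T j x t) + α * (T (j + 1) x t - T j x t)) := by
      linarith [h.equation j x t ht]
    rw [e4]
    nlinarith [sq_nonneg (dx T j x t)]
  have hmono := intervalIntegral.integral_mono_on (μ := volume) (a := -B) (b := B)
    (f := fun x => G' x - totalReaction T x t + 2 * α * layerMixing T x t) (by linarith)
    (((hG'c.sub hEc).add (hDc.const_mul (2 * α))).intervalIntegrable _ _)
    ((by fun_prop : Continuous fun x => ∑ j, (1 - 2 * T j x t) * dt T j x t).intervalIntegrable _ _)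
    fun x _ => hpt x
  rw [intervalIntegral.integral_add (f := fun x => G' x - totalReaction T x t)
    ((hG'c.sub hEc).intervalIntegrable _ _)
    ((hDc.const_mul _).intervalIntegrable _ _),
    intervalIntegral.integral_sub (hG'c.intervalIntegrable _ _) (hEc.intervalIntegrable _ _),
    intervalIntegral.integral_const_mul,
    intervalIntegral.integral_eq_sub_of_hasDerivAt (fun x _ => hGd x)
      (hG'c.intervalIntegrable _ _)] at hmono
  have g1 := abs_le.1 (hGb B (abs_of_nonneg hB))
  have g2 := abs_le.1 (hGb (-B) (by rw [abs_neg, abs_of_nonneg hB]))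
  linarith [g1.1, g2.2]

/-- Balance of the signed differences of neighbouring layers: they are driven by the differences
of the drifts and damped by reaction and exchange. -/
theorem HasTails.difference_balance (hT : HasTails T C lam τ) (h : IsClassicalSolution α A T)
    (hα : 0 ≤ α) {a : ℝ} (ha : ∀ j, |A j| ≤ a) (ht : 0 < t) (htτ : t ≤ τ)
    (hC : C ≤ C') (hd : ∀ j x, |dx T j x t| ≤ C' * Real.exp (-(lam * x)) ∧
      |dx T j x t| ≤ C' * Real.exp (lam * x)) {B : ℝ} (hB : 0 ≤ B)
    {σ : Fin N → ℝ} (hσ : ∀ j, |σ j| = 1) :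
    ∑ j, σ j * (A j - A (j - 1)) - N * (4 * (1 + a) * (C' * Real.exp (-(lam * B))))
        - 2 * (∫ x in (-B)..B, totalReaction T x t)
        - 4 * α * (2 * (∫ x in (-B)..B, totalReaction T x t)
          + ∫ x in (-B)..B, layerMixing T x t) ≤
      ∫ x in (-B)..B, ∑ j, σ j * (dt T j x t - dt T (j - 1) x t) := by
  set s : Fin N → ℝ → ℝ := fun j x => T j x t * (1 - T j x t) + α * (T (j - 1) x t - T j x t)
    + α * (T (j + 1) x t - T j x t) with hs
  set P : Fin N → ℝ → ℝ := fun j x => dx T j x t - A j * T j x t with hP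
  set Q : ℝ → ℝ := fun x => ∑ j, σ j * (P j x - P (j - 1) x) with hQ
  set Q' : ℝ → ℝ := fun x => ∑ j, σ j *
    ((dt T j x t - s j x) - (dt T (j - 1) x t - s (j - 1) x)) with hQ'
  have hc := fun j => h.continuous_space j ht.le
  have hct := fun j => h.continuous_dt j ht
  have hsc : ∀ j, Continuous (s j) := fun j => by fun_prop
  have hQ'c : Continuous Q' := by fun_prop
  have hQd : ∀ x, HasDerivAt Q (Q' x) x := fun x =>
    HasDerivAt.fun_sum fun j _ =>
      ((h.hasDerivAt_flux j x ht).sub (h.hasDerivAt_flux (j - 1) x ht)).const_mul (σ j)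
  have hEc := h.continuous_totalReaction ht.le
  have hDc := h.continuous_layerMixing ht.le
  set r : ℝ := 2 * (1 + a) * (C' * Real.exp (-(lam * B))) with hr
  have hPb : ∀ j, |P j B - P j (-B) - A j| ≤ r := by
    intro j
    have hC0 := mul_le_mul_of_nonneg_right hC (Real.exp_nonneg (-(lam * B)))
    have e1 := (hd j B).1
    have e2 : |dx T j (-B) t| ≤ C' * Real.exp (-(lam * B)) := by simpa using (hd j (-B)).2
    have e3 := (hT.right j B t ht.le htτ).trans hC0
    have e4 : 1 - T j (-B) t ≤ C' * Real.exp (-(lam * B)) := by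
      have := hT.left j (-B) t ht.le htτ
      rw [mul_neg] at this
      exact this.trans hC0
    have m1 := hT.mem j B t ht.le htτ
    have m2 := hT.mem j (-B) t ht.le htτ
    have e5 : |A j * (T j B t + (1 - T j (-B) t))| ≤ a * (2 * (C' * Real.exp (-(lam * B)))) := by
      rw [abs_mul, abs_of_nonneg (by linarith [m1.1, m2.2] : 0 ≤ T j B t + (1 - T j (-B) t))]
      exact mul_le_mul (ha j) (by linarith) (by linarith [m1.1, m2.2])
        ((abs_nonneg _).trans (ha j))
    have e6 : P j B - P j (-B) - A j =
        dx T j B t - dx T j (-B) t - A j * (T j B t + (1 - T j (-B) t)) := by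
      simp only [hP]; ring
    rw [e6, hr, abs_le]
    rw [abs_le] at e1 e2 e5
    constructor <;> linarith [e1.1, e1.2, e2.1, e2.2, e5.1, e5.2]
  have hQb : ∑ j, σ j * (A j - A (j - 1)) - N * (2 * r) ≤ Q B - Q (-B) := by
    have e1 : Q B - Q (-B) = ∑ j, σ j * (A j - A (j - 1)) + ∑ j, σ j *
        ((P j B - P j (-B) - A j) - (P (j - 1) B - P (j - 1) (-B) - A (j - 1))) := by
      simp only [hQ, ← Finset.sum_sub_distrib, ← Finset.sum_add_distrib]
      exact Finset.sum_congr rfl fun j _ => by ring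
    have e2 := neg_le_sum_signed hσ (b := fun _ => 2 * r) fun j =>
      (abs_sub (P j B - P j (-B) - A j) (P (j - 1) B - P (j - 1) (-B) - A (j - 1))).trans
        (by linarith [hPb j, hPb (j - 1)] : _ ≤ 2 * r)
    simp only [Finset.sum_const, Finset.card_univ, Fintype.card_fin, nsmul_eq_mul] at e2
    rw [e1]
    linarith
  have hpt : ∀ x, Q' x - (2 * totalReaction T x t + 4 * α * (2 * totalReaction T x t
      + layerMixing T x t)) ≤ ∑ j, σ j * (dt T j x t - dt T (j - 1) x t) := by
    intro x
    have e1 := neg_le_sum_signed_sources hα hσ (fun j => T j x t)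
      (fun j => (hT.mem j x t ht.le htτ).1) (fun j => (hT.mem j x t ht.le htτ).2)
      (fun j => s j x) fun j => rfl
    have e2 : ∑ j, σ j * (dt T j x t - dt T (j - 1) x t) =
        Q' x + ∑ j, σ j * (s j x - s (j - 1) x) := by
      simp only [hQ', ← Finset.sum_add_distrib]
      exact Finset.sum_congr rfl fun j _ => by ring
    rw [e2]
    simp only [totalReaction, layerMixing]
    linarith
  have hRc : Continuous fun x => 2 * totalReaction T x t + 4 * α * (2 * totalReaction T x t
      + layerMixing T x t) := by fun_prop
  have hmono := intervalIntegral.integral_mono_on (μ := volume) (a := -B) (b := B)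
    (f := fun x => Q' x - (2 * totalReaction T x t + 4 * α * (2 * totalReaction T x t
      + layerMixing T x t))) (by linarith)
    ((hQ'c.sub hRc).intervalIntegrable _ _)
    ((by fun_prop : Continuous fun x =>
      ∑ j, σ j * (dt T j x t - dt T (j - 1) x t)).intervalIntegrable _ _)
    fun x _ => hpt x
  have hRi : ∫ x in (-B)..B, (2 * totalReaction T x t + 4 * α * (2 * totalReaction T x t
      + layerMixing T x t)) = 2 * (∫ x in (-B)..B, totalReaction T x t)
        + 4 * α * (2 * (∫ x in (-B)..B, totalReaction T x t)
          + ∫ x in (-B)..B, layerMixing T x t) := by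
    rw [intervalIntegral.integral_add ((hEc.const_mul 2).intervalIntegrable _ _)
      ((by fun_prop : Continuous fun x => 4 * α * (2 * totalReaction T x t
      + layerMixing T x t)).intervalIntegrable _ _), intervalIntegral.integral_const_mul,
      intervalIntegral.integral_const_mul, intervalIntegral.integral_add
      ((hEc.const_mul 2).intervalIntegrable _ _) (hDc.intervalIntegrable _ _),
      intervalIntegral.integral_const_mul]
  rw [intervalIntegral.integral_sub (hQ'c.intervalIntegrable _ _) (hRc.intervalIntegrable _ _),
    hRi, intervalIntegral.integral_eq_sub_of_hasDerivAt (fun x _ => hQd x)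
      (hQ'c.intervalIntegrable _ _)] at hmono
  linarith

end Balance

/-! ### The averaged lower bound -/

section LowerBound

variable {N : ℕ} [NeZero N] {α : ℝ} {A : Fin N → ℝ} {T : Fin N → ℝ → ℝ → ℝ} {C C' lam τ t : ℝ}

/-- The weighted differential inequality applied to the truncation to `[-B, B]`; the error term
carries the factor `e^{-λ B}`. -/
theorem HasTails.truncated_lower_bound (hT : HasTails T C lam τ) (h : IsClassicalSolution α A T)
    (hα : 0 < α) {a t₀ : ℝ} (ha : ∀ j, |A j| ≤ a) (ht₀ : 0 < t₀) (ht : t₀ < τ)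
    (hC' : 0 ≤ C') (hC : C ≤ C') (hd : ∀ j x t, t₀ ≤ t → t ≤ τ →
      |dx T j x t| ≤ C' * Real.exp (-(lam * x)) ∧ |dx T j x t| ≤ C' * Real.exp (lam * x))
    {B : ℝ} (hB : 0 ≤ B) :
    (∑ j, |A (j - 1) - A j|) * (τ - t₀) / 30 ≤
      8 * (1 / (α * (τ - t₀) ^ 2) + 1 / (α * (τ - t₀)) + 1 / (τ - t₀) + α + 1)
          * (∫ t in t₀..τ, ∫ x in (-B)..B, totalReaction T x t)
        + N * (4 * (1 + a) * (C' * Real.exp (-(lam * B)))) * (3 + 1 / (α * (τ - t₀)))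
          * (τ - t₀) := by
  have ha0 : 0 ≤ a := (abs_nonneg _).trans (ha 0)
  have hBB : -B ≤ B := by linarith
  -- The signs that turn the driving differences of drifts into their absolute values.
  have hσex : ∀ j, ∃ σ : ℝ, |σ| = 1 ∧ σ * (A j - A (j - 1)) = |A (j - 1) - A j| := by
    intro j
    rw [abs_sub_comm]
    rcases abs_choice (A j - A (j - 1)) with e | e
    · exact ⟨1, by simp, by rw [e, one_mul]⟩
    · exact ⟨-1, by simp, by rw [e, neg_one_mul]⟩
  choose σ hσ hσA using hσex
  have hpos : ∀ s, t₀ ≤ s → 0 < s := fun s hs => ht₀.trans_le hs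
  have hcdt := h.continuousOn_dt
  refine mul_length_le_of_differential_ineq ht hα (by positivity)
    (E := fun t => ∫ x in (-B)..B, totalReaction T x t)
    (E' := fun t => ∫ x in (-B)..B, ∑ j, (1 - 2 * T j x t) * dt T j x t)
    (Φ := fun t => ∫ x in (-B)..B, ∑ j, σ j * (T j x t - T (j - 1) x t))
    (Φ' := fun t => ∫ x in (-B)..B, ∑ j, σ j * (dt T j x t - dt T (j - 1) x t))
    (D := fun t => ∫ x in (-B)..B, layerMixing T x t) ?_ ?_ ?_ ?_ ?_ ?_ ?_
  · exact fun t h1 _ => h.hasDerivAt_integral_totalReaction (hpos t h1) _ _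
  · intro t h1 h2
    refine hasDerivAt_intervalIntegral_of_continuousOn (hpos t h1)
      (fun s hs => continuous_finsetSum _ fun j _ => continuous_const.mul
        ((h.continuous_space j hs.le).sub (h.continuous_space (j - 1) hs.le)))
      (fun x s hs => HasDerivAt.fun_sum fun j _ =>
        ((h.hasDerivAt_time j x s hs).sub (h.hasDerivAt_time (j - 1) x s hs)).const_mul (σ j))
      (continuousOn_finsetSum _ fun j _ =>
        continuousOn_const.mul ((hcdt j).sub (hcdt (j - 1))))
  · exact fun t h1 h2 => intervalIntegral.integral_nonneg hBB fun x _ =>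
      totalReaction_nonneg fun j => hT.mem j x t (hpos t h1).le h2
  · exact fun t h1 h2 => intervalIntegral.integral_nonneg hBB fun x _ => layerMixing_nonneg x t
  · intro t h1 h2
    refine le_trans ?_ (hT.energy_balance h ha (hpos t h1) h2 hC (fun j x => hd j x t h1 h2) hB)
    have : 0 ≤ N * (2 * (1 + a) * (C' * Real.exp (-(lam * B)))) := by positivity
    linarith
  · intro t h1 h2
    refine le_trans (le_of_eq ?_) (hT.difference_balance h hα.le ha (hpos t h1) h2 hC
      (fun j x => hd j x t h1 h2) hB hσ)
    simp only [hσA]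
  · intro t h1 h2
    have hE := h.continuous_totalReaction (hpos t h1).le
    have hD := h.continuous_layerMixing (hpos t h1).le
    have key : ‖∫ x in (-B)..B, ∑ j, σ j * (T j x t - T (j - 1) x t)‖ ≤
        ∫ x in (-B)..B, (2 * totalReaction T x t + layerMixing T x t) := by
      refine intervalIntegral.norm_integral_le_of_norm_le hBB (Eventually.of_forall fun x _ => ?_)
        (((hE.const_mul 2).add hD).intervalIntegrable _ _)
      refine (Finset.abs_sum_le_sum_abs _ _).trans ?_
      refine le_trans (le_of_eq ?_) (sum_abs_sub_le (fun j => T j x t)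
        (fun j => (hT.mem j x t (hpos t h1).le h2).1)
        (fun j => (hT.mem j x t (hpos t h1).le h2).2))
      exact Finset.sum_congr rfl fun j _ => by rw [abs_mul, hσ, one_mul]
    rwa [intervalIntegral.integral_add ((hE.const_mul 2).intervalIntegrable _ _)
      (hD.intervalIntegrable _ _), intervalIntegral.integral_const_mul] at key

/-- Lower bound for the total reaction on `[0, τ]`, from the window `[t₀, τ]` with `0 < t₀`. -/
theorem HasTails.totalReaction_lower_bound (hT : HasTails T C lam τ)
    (h : IsClassicalSolution α A T) (hα : 0 < α) {t₀ : ℝ} (ht₀ : 0 < t₀) (ht : t₀ < τ)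
    (hC' : 0 ≤ C') (hC : C ≤ C') (hd : ∀ j x t, t₀ ≤ t → t ≤ τ →
      |dx T j x t| ≤ C' * Real.exp (-(lam * x)) ∧ |dx T j x t| ≤ C' * Real.exp (lam * x)) :
    (∑ j, |A (j - 1) - A j|) * (τ - t₀) / 30 ≤
      8 * (1 / (α * (τ - t₀) ^ 2) + 1 / (α * (τ - t₀)) + 1 / (τ - t₀) + α + 1)
          * (∫ t in (0 : ℝ)..τ, ∫ x, totalReaction T x t) := by
  have hτ : 0 < τ := ht₀.trans ht
  have hL : 0 < τ - t₀ := sub_pos.2 ht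
  have ha : ∀ j, |A j| ≤ ∑ j, |A j| := fun j => Finset.single_le_sum (f := fun j => |A j|)
    (fun i _ => abs_nonneg _) (Finset.mem_univ j)
  set a := ∑ j, |A j|
  set κ := 8 * (1 / (α * (τ - t₀) ^ 2) + 1 / (α * (τ - t₀)) + 1 / (τ - t₀) + α + 1) with hκ
  have hκ0 : 0 ≤ κ := by positivity
  set J := ∫ t in (0 : ℝ)..τ, ∫ x, totalReaction T x t
  have hcE := hT.continuousOn_integral_totalReaction h
  have hE0 : ∀ t, 0 ≤ t → t ≤ τ → ∀ x, 0 ≤ totalReaction T x t := fun t h1 h2 x =>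
    totalReaction_nonneg fun j => hT.mem j x t h1 h2
  have hlim : Tendsto (fun B : ℝ => κ * J + N * (4 * (1 + a) * (C' * Real.exp (-(lam * B))))
      * (3 + 1 / (α * (τ - t₀))) * (τ - t₀)) atTop (𝓝 (κ * J)) := by
    have := (((((tendsto_exp_neg_mul_atTop hT.lam_pos).const_mul C').const_mul
      (4 * (1 + a))).const_mul (N : ℝ)).mul_const (3 + 1 / (α * (τ - t₀)))).mul_const (τ - t₀)
    simpa using this.const_add (κ * J)
  refine ge_of_tendsto hlim ?_
  filter_upwards [eventually_ge_atTop 0] with B hB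
  refine (hT.truncated_lower_bound h hα ha ht₀ ht hC' hC hd hB).trans ?_
  refine add_le_add_left (mul_le_mul_of_nonneg_left ?_ hκ0) _
  have hBB : -B ≤ B := by linarith
  have hcB : ContinuousOn (fun t => ∫ x in (-B)..B, totalReaction T x t) (Set.Icc t₀ τ) :=
    fun t ht' => (h.hasDerivAt_integral_totalReaction
      (ht₀.trans_le ht'.1) _ _).continuousAt.continuousWithinAt
  have hi0 : IntervalIntegrable (fun t => ∫ x, totalReaction T x t) volume 0 t₀ :=
    (hcE.mono (Set.Icc_subset_Icc_right ht.le)).intervalIntegrable_of_Icc ht₀.le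
  have hi1 : IntervalIntegrable (fun t => ∫ x, totalReaction T x t) volume t₀ τ :=
    (hcE.mono (Set.Icc_subset_Icc_left ht₀.le)).intervalIntegrable_of_Icc ht.le
  have h1 : ∫ t in t₀..τ, ∫ x in (-B)..B, totalReaction T x t ≤
      ∫ t in t₀..τ, ∫ x, totalReaction T x t := by
    refine intervalIntegral.integral_mono_on ht.le (hcB.intervalIntegrable_of_Icc ht.le) hi1
      fun t ht' => ?_
    have ht0 := ht₀.le.trans ht'.1
    rw [intervalIntegral.integral_of_le hBB]
    exact setIntegral_le_integral (hT.integrable_totalReaction h ht0 ht'.2)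
      (Eventually.of_forall fun x => hE0 t ht0 ht'.2 x)
  have h2 : 0 ≤ ∫ t in (0 : ℝ)..t₀, ∫ x, totalReaction T x t :=
    intervalIntegral.integral_nonneg ht₀.le fun t ht' =>
      integral_nonneg fun x => hE0 t ht'.1 (ht'.2.trans ht.le) x
  have h3 : J = (∫ t in (0 : ℝ)..t₀, ∫ x, totalReaction T x t) +
    ∫ t in t₀..τ, ∫ x, totalReaction T x t :=
    (intervalIntegral.integral_add_adjacent_intervals hi0 hi1).symm
  linarith

/-- The tail bounds on `[0, τ]` and, for each initial time `t₀ > 0`, those of the spatial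
derivative on `[t₀, τ]`. -/
theorem exists_hasTails (h : IsClassicalSolution α A T) (hα : 0 ≤ α)
    (h0 : ∀ j x, 0 ≤ T j x 0 ∧ T j x 0 ≤ 1) (hF : FrontLike (fun j x => T j x 0)) (τ : ℝ) :
    ∃ C lam : ℝ, HasTails T C lam τ ∧ ∀ t₀, 0 < t₀ → t₀ ≤ τ → ∃ C', 0 ≤ C' ∧ C ≤ C' ∧
      ∀ j x t, t₀ ≤ t → t ≤ τ →
        |dx T j x t| ≤ C' * Real.exp (-(lam * x)) ∧ |dx T j x t| ≤ C' * Real.exp (lam * x) := by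
  obtain ⟨C, lam, hC, hlam, hb⟩ := exists_tail_bounds h hα h0 hF τ
  refine ⟨C, lam, ⟨hlam, fun j x t h1 _ => ⟨h.nonneg hα (fun j x => (h0 j x).1) j x h1,
    h.le_one hα h0 j x h1⟩, fun j x t h1 h2 => (hb j x t h1 h2).1,
    fun j x t h1 h2 => (hb j x t h1 h2).2⟩, fun t₀ ht₀ ht₀τ => ?_⟩
  obtain ⟨C', hC', hd⟩ := exists_deriv_bound h hα h0 ht₀ ht₀τ hC hlam hb
  refine ⟨max C C', hC.trans (le_max_left _ _), le_max_left _ _, fun j x t h1 h2 => ?_⟩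
  obtain ⟨d1, d2⟩ := hd j x t h1 h2
  exact ⟨d1.trans (mul_le_mul_of_nonneg_right (le_max_right _ _) (Real.exp_nonneg _)),
    d2.trans (mul_le_mul_of_nonneg_right (le_max_right _ _) (Real.exp_nonneg _))⟩

end LowerBound

end LayerModel

theorem theorem1p1 :
    ∃ C : ℝ, 0 < C ∧
      ∀ (N : ℕ) [NeZero N] (α : ℝ) (A : Fin N → ℝ) (T : Fin N → ℝ → ℝ → ℝ),
        0 < α →
        ∑ j, A j = 0 →
        LayerModel.IsClassicalSolution α A T →
        (∀ j x, 0 ≤ T j x 0 ∧ T j x 0 ≤ 1) →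
        LayerModel.FrontLike (fun j x => T j x 0) →
        (∀ t, 0 < t → ∀ j,
          LayerModel.HasImproperIntegral (fun x => LayerModel.dt T j x t)
            (LayerModel.improperIntegral (fun x => LayerModel.dt T j x t))) ∧
        ∀ τ : ℝ, 0 < τ →
          IntervalIntegrable (LayerModel.bulkBurningRate T) volume 0 τ ∧
          (1 / τ) * (∫ t in (0 : ℝ)..τ, LayerModel.bulkBurningRate T t) ≥
            C / (N : ℝ) * (∑ j, |A (j - 1) - A j|) *
              (1 / (α * τ ^ 2) + 1 / (α * τ) + 1 / τ + α + 1)⁻¹ := by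
  -- `1920 = 30 * 8 * 4 * 2`: the last two factors come from halving the length of the window.
  refine ⟨1 / 1920, by norm_num, fun N _ α A T hα hA h h0 hF => ⟨fun t ht j => ?_, fun τ hτ => ?_⟩⟩
  · obtain ⟨C, lam, hT, hd⟩ := LayerModel.exists_hasTails h hα.le h0 hF t
    obtain ⟨C', -, -, hd⟩ := hd t ht le_rfl
    have hI := hT.hasImproperIntegral_dt h ht le_rfl (fun j x => hd j x t le_rfl le_rfl) j
    rw [LayerModel.improperIntegral, hI.limUnder_eq]
    exact hI
  · obtain ⟨C, lam, hT, hd⟩ := LayerModel.exists_hasTails h hα.le h0 hF τ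
    have hV : ∀ t ∈ Set.Ioc 0 τ,
        (1 / (N : ℝ)) * (∫ x, LayerModel.totalReaction T x t) = LayerModel.bulkBurningRate T t := by
      intro t ht
      obtain ⟨C', -, -, hd'⟩ := hd t ht.1 ht.2
      exact (hT.bulkBurningRate_eq h hA ht.1 ht.2 fun j x => hd' j x t le_rfl ht.2).symm
    have hi : IntervalIntegrable (fun t => (1 / (N : ℝ)) * ∫ x, LayerModel.totalReaction T x t)
        volume 0 τ :=
      ((hT.continuousOn_integral_totalReaction h).intervalIntegrable_of_Icc hτ.le).const_mul _
    -- The value of the burning rate at `t = 0` is irrelevant to the integral.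
    have hVu : Set.EqOn (fun t => (1 / (N : ℝ)) * ∫ x, LayerModel.totalReaction T x t)
        (LayerModel.bulkBurningRate T) (Set.uIoc 0 τ) := by
      rw [Set.uIoc_of_le hτ.le]; exact hV
    refine ⟨hi.congr hVu, ?_⟩
    rw [← intervalIntegral.integral_congr_ae (Eventually.of_forall hVu),
      intervalIntegral.integral_const_mul]
    obtain ⟨C', hC', hCC', hd'⟩ := hd (τ / 2) (half_pos hτ) (by linarith)
    have key := hT.totalReaction_lower_bound h hα (half_pos hτ) (by linarith) hC' hCC' hd'
    set J := ∫ t in (0 : ℝ)..τ, ∫ x, LayerModel.totalReaction T x t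
    set S := ∑ j, |A (j - 1) - A j|
    set Q := 1 / (α * τ ^ 2) + 1 / (α * τ) + 1 / τ + α + 1 with hQ
    have hQ0 : 0 < Q := by positivity
    have hN : 0 < (N : ℝ) := Nat.cast_pos.2 (NeZero.pos N)
    have hJ0 : 0 ≤ J := intervalIntegral.integral_nonneg hτ.le fun t ht =>
      integral_nonneg fun x => LayerModel.totalReaction_nonneg fun j => hT.mem j x t ht.1 ht.2
    have hhalf : τ - τ / 2 = τ / 2 := by ring
    rw [hhalf] at key
    have hκ : 8 * (1 / (α * (τ / 2) ^ 2) + 1 / (α * (τ / 2)) + 1 / (τ / 2) + α + 1) ≤ 32 * Q := by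
      have e1 : 1 / (α * (τ / 2) ^ 2) = 4 * (1 / (α * τ ^ 2)) := by field_simp; norm_num
      have e2 : 1 / (α * (τ / 2)) = 2 * (1 / (α * τ)) := by field_simp
      have e3 : 1 / (τ / 2) = 2 * (1 / τ) := by field_simp
      have p1 : 0 < 1 / (α * τ) := by positivity
      have p2 : 0 < 1 / τ := by positivity
      rw [e1, e2, e3, hQ]
      linarith
    have key2 : S * τ ≤ 1920 * Q * J := by
      have := mul_le_mul_of_nonneg_right hκ hJ0
      linarith
    have e1 : 1 / τ * (1 / (N : ℝ) * J) = J / (τ * N) := by field_simp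
    have e2 : 1 / 1920 / (N : ℝ) * S * Q⁻¹ = S / (1920 * N * Q) := by field_simp
    rw [ge_iff_le, e1, e2, div_le_div_iff₀ (by positivity) (by positivity)]
    have := mul_le_mul_of_nonneg_right key2 hN.le
    linarith
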